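/- Let $M$ be a smooth $2n$-manifold, $n\ge 2$, with an $SU(n)$-structure, i.e. a Riemannian metric $\langle\cdot,\cdot\rangle$, an orthogonal almost complex structure $I$, and a complex volume form $\Psi=\psi_++i\psi_-$: a complex-valued $n$-form with $\Psi(Ix_1,x_2,\dots,x_n)=i\,\Psi(x_1,\dots,x_n)$ and $\langle\Psi,\Psi\rangle_{\mathbb C}=1$, that is, $|\Psi(u_1,\dots,u_n)|=1$ for every unitary basis $u_1,\dots,u_n$ with respect to $\langle x,y\rangle_{\mathbb C}=\langle x,y\rangle+i\langle x,Iy\rangle$. Let $\omega(x,y)=\langle x,Iy\rangle$ be the Kähler form, let $\nabla$ be the Levi-Civita connection, let $d^*\omega=-\sum_i(\nabla_{e_i}\omega)(e_i,\cdot)$ ($e_i$ an orthonormal frame) be the coderivative of $\omega$, and for a one-form $\mu$ put $(I\mu)(X)=-\mu(IX)$. The intrinsic torsion of the structure is $\overline\nabla-\nabla$, where $\overline\nabla$ is the minimal $SU(n)$-connection, i.e. the connection for which $\langle\cdot,\cdot\rangle,\omega,\psi_+,\psi_-$ are parallel and such that, for every $X$, $\overline\nabla_X-\nabla_X$ lies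 in $\mathfrak{su}(n)^\perp=\mathbb R I\oplus\mathfrak u(n)^\perp\subset\mathfrak{so}(2n)$. Let $\eta$ be the one-form (the $\mathcal W_5$-part of the intrinsic torsion) such that the $\mathbb R I$-component of $\overline\nabla_X-\nabla_X$ is $(I\eta)(X)\,I$. Let $f$ be a smooth real function on $M$, and let $\omega_o$, $\eta_o$ and $d^*\omega_o$ be the Kähler form, the $\mathcal W_5$ one-form and the coderivative of $\omega_o$ for the $SU(n)$-structure $(\langle\cdot,\cdot\rangle_o=e^{2f}\langle\cdot,\cdot\rangle,\ I,\ \Psi_o=e^{nf}\Psi)$, where the coderivative is taken with respect to $\langle\cdot,\cdot\rangle_o$. Then $$ I d^*\omega_o = I d^*\omega-2(n-1)\,df,\qquad \eta_o=\eta-\frac1n\,df, $$ and hence $$ 2n(n-1)\,\eta_o-I d^*\omega_o=2n(n-1)\,\eta-I d^*\omega, $$ i.e. the one-form $2n(n-1)\eta-Id^*\omega$ is invariant under conformal changes of the metric. -/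

import Mathlib

open Bundle
open scoped Manifold ContDiff

namespace SpecialHermitian

noncomputable section LeviCivita

variable {E : Type*} [NormedAddCommGroup E] [NormedSpace ℝ E] [FiniteDimensional ℝ E]
  {H : Type*} [TopologicalSpace H] {I : ModelWithCorners ℝ E H}
  {M : Type*} [TopologicalSpace M] [ChartedSpace H M] [IsManifold I ∞ M]

/-- Smooth Riemannian metrics on `M`. -/
abbrev Metric {E : Type*} [NormedAddCommGroup E] [NormedSpace ℝ E]
    {H : Type*} [TopologicalSpace H] (I : ModelWithCorners ℝ E H)
    (M : Type*) [TopologicalSpace M] [ChartedSpace H M] [IsManifold I ∞ M] :=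
  ContMDiffRiemannianMetric I ∞ E (fun p : M => TangentSpace I p)

/-- Connections on the tangent bundle. -/
abbrev Connection {E : Type*} [NormedAddCommGroup E] [NormedSpace ℝ E]
    {H : Type*} [TopologicalSpace H] (I : ModelWithCorners ℝ E H)
    (M : Type*) [TopologicalSpace M] [ChartedSpace H M] [IsManifold I ∞ M] :=
  CovariantDerivative I E (fun p : M => TangentSpace I p)

/-- `D` is a Levi-Civita connection of `g`: it is torsion-free and metric. -/
structure IsLeviCivita (g : Metric I M) (D : Connection I M) : Prop where
  torsion_free : D.torsion = 0
  metric : ∀ (p : M) (u : TangentSpace I p) (Y Z : Π q : M, TangentSpace I q),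
    MDiffAt (T% Y) p → MDiffAt (T% Z) p →
    d% (fun q => g.inner q (Y q) (Z q)) p u =
      g.inner p (D Y p u) (Z p) + g.inner p (Y p) (D Z p u)

open VectorField in
/-- Half the right-hand side of the Koszul formula. -/
def koszul (g : Metric I M) (Y X Z : Π q : M, TangentSpace I q) (p : M) : ℝ :=
  (1 / 2) * (d% (fun q => g.inner q (Y q) (Z q)) p (X p)
    + d% (fun q => g.inner q (X q) (Z q)) p (Y p)
    - d% (fun q => g.inner q (X q) (Y q)) p (Z p)
    + g.inner p (mlieBracket I X Y p) (Z p)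
    - g.inner p (mlieBracket I X Z p) (Y p)
    - g.inner p (mlieBracket I Y Z p) (X p))

lemma mdiffAt_inner (g : Metric I M) {p : M} {Y Z : Π q : M, TangentSpace I q}
    (hY : MDiffAt (T% Y) p) (hZ : MDiffAt (T% Z) p) :
    MDiffAt (fun q => g.inner q (Y q) (Z q)) p := by
  let _ : RiemannianBundle (fun p : M => TangentSpace I p) := ⟨g.toRiemannianMetric⟩
  have : IsContMDiffRiemannianBundle I 1 E
      (fun p : M => TangentSpace I p) := inferInstance
  exact MDifferentiableAt.inner_bundle (F := E)
      (E := fun p : M => TangentSpace I p) hY hZ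

open VectorField in
lemma koszul_tensorial_Z (g : Metric I M) {p : M} {X Y : Π q : M, TangentSpace I q}
    (hX : MDiffAt (T% X) p) (hY : MDiffAt (T% Y) p) :
    TensorialAt I E (fun Z => koszul g Y X Z p) p where
  smul {f Z} hf hZ := by
    have e1 := mvfderiv_mul hf (mdiffAt_inner g hY hZ)
    have e2 := mvfderiv_mul hf (mdiffAt_inner g hX hZ)
    simp only [koszul, Pi.smul_apply', map_smul, smul_eq_mul, mlieBracket_smul_right hf hZ]
    simp only [Pi.mul_def] at e1 e2
    rw [e1, e2]
    simp
    rw [g.symm p (Z p) (Y p), g.symm p (Z p) (X p)]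
    ring
  add {Z W} hZ hW := by
    have e1 := mvfderiv_add (mdiffAt_inner g hY hZ) (mdiffAt_inner g hY hW)
    have e2 := mvfderiv_add (mdiffAt_inner g hX hZ) (mdiffAt_inner g hX hW)
    simp only [Pi.add_def] at e1 e2
    simp only [koszul, Pi.add_apply, map_add, mlieBracket_add_right hZ hW]
    rw [e1, e2]
    simp
    ring

open VectorField in
lemma koszul_tensorial_X (g : Metric I M) {p : M} {Y Z : Π q : M, TangentSpace I q}
    (hY : MDiffAt (T% Y) p) (hZ : MDiffAt (T% Z) p) :
    TensorialAt I E (fun X => koszul g Y X Z p) p where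
  smul {f X} hf hX := by
    have e1 := mvfderiv_mul hf (mdiffAt_inner g hX hZ)
    have e2 := mvfderiv_mul hf (mdiffAt_inner g hX hY)
    simp only [koszul, Pi.smul_apply', map_smul, smul_eq_mul, mlieBracket_smul_left hf hX]
    simp only [Pi.mul_def] at e1 e2
    simp only [FunLike.coe_smul, Pi.smul_apply, smul_eq_mul]
    rw [e1, e2]
    simp
    ring
  add {X W} hX hW := by
    have e1 := mvfderiv_add (mdiffAt_inner g hX hZ) (mdiffAt_inner g hW hZ)
    have e2 := mvfderiv_add (mdiffAt_inner g hX hY) (mdiffAt_inner g hW hY)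
    simp only [Pi.add_def] at e1 e2
    simp only [koszul, Pi.add_apply, map_add, mlieBracket_add_left hX hW, FunLike.coe_add]
    rw [e1, e2]
    simp
    ring

/-- The Koszul expression as a bilinear form in `X p` and `Z p`. -/
def koszulForm (g : Metric I M) (Y : Π q : M, TangentSpace I q) (p : M)
    (hY : MDiffAt (T% Y) p) : TangentSpace I p →L[ℝ] TangentSpace I p →L[ℝ] ℝ :=
  TensorialAt.mkHom₂ (fun X Z => koszul g Y X Z p) p
    (fun _ hZ => koszul_tensorial_X g hY hZ) (fun _ hX => koszul_tensorial_Z g hX hY)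

lemma inner_bijective (g : Metric I M) (p : M) : Function.Bijective (g.inner p) := by
  have hfd : FiniteDimensional ℝ (TangentSpace I p) := inferInstanceAs (FiniteDimensional ℝ E)
  have hinj : Function.Injective (g.inner p) := by
    rw [injective_iff_map_eq_zero]
    intro v hv
    by_contra h
    have := g.pos p v h
    simp [hv] at this
  refine ⟨hinj, ?_⟩
  have hfd' : FiniteDimensional ℝ (E →L[ℝ] ℝ) := inferInstance
  have hd : Module.finrank ℝ E = Module.finrank ℝ (E →L[ℝ] ℝ) := by
    rw [← (LinearMap.toContinuousLinearMap (𝕜 := ℝ) (E := E) (F' := ℝ)).finrank_eq]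
    exact (Subspace.dual_finrank_eq (K := ℝ) (V := E)).symm
  let L : E →ₗ[ℝ] (E →L[ℝ] ℝ) := (g.inner p).toLinearMap
  exact (LinearMap.injective_iff_surjective_of_finrank_eq_finrank (f := L) hd).1 hinj

/-- The musical isomorphism `T*M → TM` at `p`. -/
def sharp (g : Metric I M) (p : M) : (TangentSpace I p →L[ℝ] ℝ) →ₗ[ℝ] TangentSpace I p :=
  (LinearEquiv.ofBijective (g.inner p).toLinearMap (inner_bijective g p)).symm.toLinearMap

lemma inner_sharp (g : Metric I M) (p : M) (φ : TangentSpace I p →L[ℝ] ℝ)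
    (v : TangentSpace I p) : g.inner p (sharp g p φ) v = φ v := by
  have := (LinearEquiv.ofBijective (g.inner p).toLinearMap
    (inner_bijective g p)).apply_symm_apply φ
  exact congrArg (fun ψ : TangentSpace I p →L[ℝ] ℝ => ψ v) this

lemma inner_ext (g : Metric I M) (p : M) {u v : TangentSpace I p}
    (h : ∀ w, g.inner p u w = g.inner p v w) : u = v :=
  (inner_bijective g p).1 (ContinuousLinearMap.ext h)

open Classical in
/-- The Koszul connection. -/
def koszulFun (g : Metric I M) (Y : Π q : M, TangentSpace I q) (p : M) :
    TangentSpace I p →L[ℝ] TangentSpace I p :=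
  have : FiniteDimensional ℝ (TangentSpace I p) := inferInstanceAs (FiniteDimensional ℝ E)
  have : T2Space (TangentSpace I p) := inferInstanceAs (T2Space E)
  if hY : MDiffAt (T% Y) p then
    LinearMap.toContinuousLinearMap (sharp g p ∘ₗ (koszulForm g Y p hY).toLinearMap)
  else 0

lemma inner_koszulFun (g : Metric I M) {X Y Z : Π q : M, TangentSpace I q} {p : M}
    (hX : MDiffAt (T% X) p) (hY : MDiffAt (T% Y) p) (hZ : MDiffAt (T% Z) p) :
    g.inner p (koszulFun g Y p (X p)) (Z p) = koszul g Y X Z p := by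
  have h1 : koszulFun g Y p (X p) = sharp g p (koszulForm g Y p hY (X p)) := by
    simp [koszulFun, hY]
  rw [h1, inner_sharp]
  exact TensorialAt.mkHom₂_apply (Φ := fun X Z => koszul g Y X Z p)
    (fun _ hZ => koszul_tensorial_X g hY hZ) (fun _ hX => koszul_tensorial_Z g hX hY) hX hZ

open VectorField in
lemma koszulFun_isCovariantDerivativeOn (g : Metric I M) :
    IsCovariantDerivativeOn E (koszulFun (I := I) g) where
  add {Y W p} hY hW _ := by
    ext u
    refine inner_ext g p fun w => ?_
    have hu := FiberBundle.mdifferentiableAt_extend I E (V := fun p : M => TangentSpace I p) u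
    have hw := FiberBundle.mdifferentiableAt_extend I E (V := fun p : M => TangentSpace I p) w
    have hYW := mdifferentiableAt_add_section hY hW
    have k1 := inner_koszulFun g hu hY hw
    have k2 := inner_koszulFun g hu hW hw
    have k3 := inner_koszulFun g hu hYW hw
    simp only [FiberBundle.extend_apply_self] at k1 k2 k3
    have e1 := mvfderiv_add (mdiffAt_inner g hY hw) (mdiffAt_inner g hW hw)
    have e2 := mvfderiv_add (mdiffAt_inner g hu hY) (mdiffAt_inner g hu hW)
    simp only [Pi.add_def] at e1 e2
    simp only [FunLike.coe_add, Pi.add_apply, map_add]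
    rw [k1, k2]
    refine k3.trans ?_
    simp only [koszul, Pi.add_apply, map_add, mlieBracket_add_left hY hW,
      mlieBracket_add_right hY hW, FunLike.coe_add, FiberBundle.extend_apply_self]
    rw [e1, e2]
    simp
    ring
  leibniz {Y f p} hY hf _ := by
    ext u
    refine inner_ext g p fun w => ?_
    have hu := FiberBundle.mdifferentiableAt_extend I E (V := fun p : M => TangentSpace I p) u
    have hw := FiberBundle.mdifferentiableAt_extend I E (V := fun p : M => TangentSpace I p) w
    have hfY := hf.smul_section hY
    have k1 := inner_koszulFun g hu hY hw
    have k3 := inner_koszulFun g hu hfY hw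
    simp only [FiberBundle.extend_apply_self] at k1 k3
    have e1 := mvfderiv_mul hf (mdiffAt_inner g hY hw)
    have e2 := mvfderiv_mul hf (mdiffAt_inner g hu hY)
    simp only [Pi.mul_def] at e1 e2
    simp only [FunLike.coe_add, Pi.add_apply, map_add, FunLike.coe_smul, Pi.smul_apply, map_smul,
      smul_eq_mul, ContinuousLinearMap.smulRight_apply]
    rw [k1]
    refine k3.trans ?_
    simp only [koszul, Pi.smul_apply', map_smul, mlieBracket_smul_left hf hY,
      mlieBracket_smul_right hf hY, FunLike.coe_smul, Pi.smul_apply, smul_eq_mul,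
      FiberBundle.extend_apply_self]
    rw [e1, e2]
    simp
    rw [g.symm p u (Y p)]
    ring

open VectorField in
/-- Every Riemannian metric has a Levi-Civita connection. -/
theorem exists_isLeviCivita (g : Metric I M) : ∃ D : Connection I M, IsLeviCivita g D := by
  refine ⟨⟨koszulFun g, koszulFun_isCovariantDerivativeOn g⟩, ?_, ?_⟩
  · rw [CovariantDerivative.torsion_eq_zero_iff]
    intro X Y p hX hY
    refine inner_ext g p fun w => ?_
    have hw := FiberBundle.mdifferentiableAt_extend I E (V := fun p : M => TangentSpace I p) w
    have k1 := inner_koszulFun g hX hY hw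
    have k2 := inner_koszulFun g hY hX hw
    simp only [FiberBundle.extend_apply_self] at k1 k2
    rw [map_sub, FunLike.coe_sub, Pi.sub_apply]
    refine (congrArg₂ (· - ·) k1 k2).trans ?_
    have hs : (fun q => g.inner q (X q) (Y q)) = fun q => g.inner q (Y q) (X q) := by
      ext q; exact g.symm q _ _
    simp only [koszul, FiberBundle.extend_apply_self]
    rw [hs, mlieBracket_swap_apply (V := Y) (W := X)]
    simp
    ring
  · intro p u Y Z hY hZ
    have hu := FiberBundle.mdifferentiableAt_extend I E (V := fun p : M => TangentSpace I p) u
    have k1 := inner_koszulFun g hu hY hZ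
    have k2 := inner_koszulFun g hu hZ hY
    simp only [FiberBundle.extend_apply_self] at k1 k2
    have hs : (fun q => g.inner q (Y q) (Z q)) = fun q => g.inner q (Z q) (Y q) := by
      ext q; exact g.symm q _ _
    change _ = g.inner p (koszulFun g Y p u) (Z p) + g.inner p (Y p) (koszulFun g Z p u)
    rw [g.symm p (Y p), k1, k2]
    simp only [koszul, FiberBundle.extend_apply_self]
    rw [hs, mlieBracket_swap_apply (V := Z) (W := Y)]
    simp
    ring

/-- The Levi-Civita connection of `g`. Its values on differentiable vector fields are determined
by the two properties in `IsLeviCivita`. -/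
def leviCivita (g : Metric I M) : Connection I M := (exists_isLeviCivita g).choose

lemma leviCivita_spec (g : Metric I M) : IsLeviCivita g (leviCivita g) :=
  (exists_isLeviCivita g).choose_spec

end LeviCivita

noncomputable section SpecialAlmostHermitianStructures

variable {E : Type*} [NormedAddCommGroup E] [NormedSpace ℝ E] [FiniteDimensional ℝ E]
  {H : Type*} [TopologicalSpace H] {I : ModelWithCorners ℝ E H}
  {M : Type*} [TopologicalSpace M] [ChartedSpace H M] [IsManifold I ∞ M]

/-- The covariant derivative `(∇_u T)(v₁, …, v_s)` at `p` of a real `(0,s)`-tensor field `T`: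
`u (T(V₁, …, V_s)) - ∑ i, T(v₁, …, ∇_u V_i, …, v_s)`, where `V_i` is an extension of `v_i` to a
vector field that is smooth near `p`. -/
def covDeriv (D : Connection I M) {s : ℕ} (T : Π p : M, (Fin s → TangentSpace I p) → ℝ)
    (p : M) (u : TangentSpace I p) (v : Fin s → TangentSpace I p) : ℝ :=
  d% (fun q => T q (fun i => FiberBundle.extend E (v i) q)) p u
    - ∑ i, T p (Function.update v i (D (FiberBundle.extend E (v i)) p u))

/-- The trace `∑ g^{ij} B(b_i, b_j)` of a bilinear form `B` with respect to the metric, where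
`b` is a basis of `T_p M` (any basis gives the same value) and `g^{ij}` is the inverse of the
Gram matrix. -/
def metricTrace (g : Metric I M) (p : M) (B : TangentSpace I p → TangentSpace I p → ℝ) : ℝ :=
  let b : Module.Basis (Fin (Module.finrank ℝ E)) ℝ (TangentSpace I p) := Module.finBasis ℝ E
  let G : Matrix (Fin (Module.finrank ℝ E)) (Fin (Module.finrank ℝ E)) ℝ :=
    Matrix.of fun i j => g.inner p (b i) (b j)
  ∑ i, ∑ j, G⁻¹ i j * B (b i) (b j)

/-- The coderivative `d*α = -∑ (∇_{e_i} α)(e_i, ·)` of a two-form, with `e_i` orthonormal. -/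
def codiff₂ (g : Metric I M) (α : Π p : M, (Fin 2 → TangentSpace I p) → ℝ)
    (p : M) (v : TangentSpace I p) : ℝ :=
  -metricTrace g p fun a b => covDeriv (leviCivita g) α p a ![b, v]

/-- The inner product `tr(Aᵀ B) = -tr(A B)` on the skew-symmetric endomorphisms of `T_p M`. -/
def soInner {p : M} (A B : Module.End ℝ (TangentSpace I p)) : ℝ :=
  -LinearMap.trace ℝ (TangentSpace I p) (A * B)

/-- An `SU(n)`-structure on the `2n`-manifold `M`: a Riemannian metric `⟨·,·⟩`, an orthogonal
almost complex structure `J` and a complex volume form `Ψ` with `⟨Ψ, Ψ⟩_ℂ = 1`. -/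
structure SpecialAlmostHermitian (n : ℕ) {E : Type*} [NormedAddCommGroup E] [NormedSpace ℝ E]
    {H : Type*} [TopologicalSpace H] (I : ModelWithCorners ℝ E H)
    (M : Type*) [TopologicalSpace M] [ChartedSpace H M] [IsManifold I ∞ M] where
  dim_eq : Module.finrank ℝ E = 2 * n
  metric : Metric I M
  J : Π p : M, TangentSpace I p →L[ℝ] TangentSpace I p
  J_smooth : ∀ (p : M) (V : Π q : M, TangentSpace I q),
    CMDiffAt ∞ (T% V) p → CMDiffAt ∞ (T% fun q => J q (V q)) p
  J_sq : ∀ (p : M) (v : TangentSpace I p), J p (J p v) = -v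
  J_orthogonal : ∀ (p : M) (v w : TangentSpace I p),
    metric.inner p (J p v) (J p w) = metric.inner p v w
  Psi : Π p : M, (TangentSpace I p) [⋀^Fin n]→L[ℝ] ℂ
  Psi_smooth : ∀ (p : M) (V : Fin n → Π q : M, TangentSpace I q),
    (∀ i, CMDiffAt ∞ (T% (V i)) p) →
      ContMDiffAt I 𝓘(ℝ, ℂ) ∞ (fun q => Psi q fun i => V i q) p
  Psi_complexLinear : ∀ (p : M) (v : Fin n → TangentSpace I p) (i : Fin n),
    Psi p (Function.update v i (J p (v i))) = Complex.I * Psi p v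
  /-- `⟨Ψ, Ψ⟩_ℂ = 1`, computed in unitary bases `u` for `⟨x, y⟩_ℂ = ⟨x, y⟩ + i ⟨x, J y⟩`. -/
  Psi_normalized : ∀ (p : M) (u : Fin n → TangentSpace I p),
    (∀ i j, (metric.inner p (u i) (u j) : ℂ) + Complex.I * metric.inner p (u i) (J p (u j))
      = if i = j then 1 else 0) →
    (1 / (n.factorial : ℂ)) * ∑ k : Fin n → Fin n,
      Psi p (fun a => u (k a)) * (starRingEnd ℂ) (Psi p fun a => u (k a)) = 1

/-- The metric `e^{2f} ⟨·,·⟩`. -/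
def conformalMetric (g : Metric I M) (f : M → ℝ) (hf : CMDiff ∞ f) : Metric I M where
  inner p := Real.exp (2 * f p) • g.inner p
  symm p v w := by simp [g.symm p v w]
  pos p v hv := by
    have := g.pos p v hv
    simp only [FunLike.coe_smul, Pi.smul_apply, smul_eq_mul]
    positivity
  isVonNBounded p := by
    refine ((g.isVonNBounded p).image
      (Real.exp (-f p) • ContinuousLinearMap.id ℝ (TangentSpace I p))).subset ?_
    intro v hv
    refine ⟨Real.exp (f p) • v, ?_, ?_⟩
    · have h2 : Real.exp (2 * f p) = Real.exp (f p) * Real.exp (f p) := by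
        rw [← Real.exp_add]; ring_nf
      simpa [h2, mul_assoc] using hv
    · simp [smul_smul, ← Real.exp_add]
  contMDiff := by
    have h1 : CMDiff ∞ (fun q => Real.exp (2 * f q)) :=
      Real.contDiff_exp.contMDiff.comp (contMDiff_const.mul hf)
    exact h1.smul_section g.contMDiff

namespace SpecialAlmostHermitian

variable {n : ℕ} (S : SpecialAlmostHermitian n I M)

/-- The Kähler form `ω(x, y) = ⟨x, J y⟩`. -/
def omega (p : M) (v : Fin 2 → TangentSpace I p) : ℝ := S.metric.inner p (v 0) (S.J p (v 1))

/-- `ψ₊`, the real part of the complex volume form. -/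
def psiPlus (p : M) (v : Fin n → TangentSpace I p) : ℝ := (S.Psi p v).re

/-- `ψ₋`, the imaginary part of the complex volume form. -/
def psiMinus (p : M) (v : Fin n → TangentSpace I p) : ℝ := (S.Psi p v).im

/-- The action `(I μ)(x) = -μ(J x)` of the almost complex structure on one-forms. -/
def actJ (μ : Π p : M, TangentSpace I p → ℝ) (p : M) (x : TangentSpace I p) : ℝ :=
  -μ p (S.J p x)

/-- `A` belongs to the Lie algebra `su(n)` of the stabiliser of `⟨·,·⟩`, `ω` and `Ψ` at `p`. -/
structure IsSU (p : M) (A : Module.End ℝ (TangentSpace I p)) : Prop where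
  metric : ∀ v w, S.metric.inner p (A v) w + S.metric.inner p v (A w) = 0
  omega : ∀ v, ∑ i, S.omega p (Function.update v i (A (v i))) = 0
  psiPlus : ∀ v, ∑ i, S.psiPlus p (Function.update v i (A (v i))) = 0
  psiMinus : ∀ v, ∑ i, S.psiMinus p (Function.update v i (A (v i))) = 0

/-- The difference `Y ↦ D_u Y - ∇_u Y` of a connection `D` and the Levi-Civita connection. -/
def torsionOf (D : Connection I M) (p : M) (u : TangentSpace I p) :
    Module.End ℝ (TangentSpace I p) where
  toFun Y := D.difference (leviCivita S.metric) p Y u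
  map_add' := by simp
  map_smul' := by simp

/-- `D` is the minimal `SU(n)`-connection: `⟨·,·⟩`, `ω`, `ψ₊` and `ψ₋` are `D`-parallel and
`D - ∇` takes its values in the orthogonal complement of `su(n)` in `so(2n)`. -/
structure IsMinimal (D : Connection I M) : Prop where
  metric : ∀ p u v, covDeriv D (fun q (v : Fin 2 → TangentSpace I q) =>
    S.metric.inner q (v 0) (v 1)) p u v = 0
  omega : ∀ p u v, covDeriv D S.omega p u v = 0
  psiPlus : ∀ p u v, covDeriv D S.psiPlus p u v = 0
  psiMinus : ∀ p u v, covDeriv D S.psiMinus p u v = 0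
  orthogonal : ∀ p u A, S.IsSU p A → soInner (S.torsionOf D p u) A = 0

open Classical in
/-- The minimal `SU(n)`-connection. It exists and, on differentiable vector fields, it is
unique; the value in the case without such a connection is never used. -/
def minimalConnection : Connection I M :=
  if h : ∃ D, S.IsMinimal D then h.choose else leviCivita S.metric

/-- The intrinsic `SU(n)`-torsion. -/
def intrinsicTorsion (p : M) (u : TangentSpace I p) : Module.End ℝ (TangentSpace I p) :=
  S.torsionOf S.minimalConnection p u

/-- The one-form `c` for which `c(u) J` is the component in `ℝ J` of the intrinsic torsion in the
orthogonal decomposition `su(n)^⊥ = ℝ J ⊕ u(n)^⊥`. -/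
def lineComponent (p : M) (u : TangentSpace I p) : ℝ :=
  soInner (S.intrinsicTorsion p u) (S.J p).toLinearMap /
    soInner (S.J p).toLinearMap (S.J p).toLinearMap

/-- The one-form `η` representing the `W₅`-part of the intrinsic torsion: the component of the
intrinsic torsion in `ℝ J` is `(I η)(u) J`. Since `I (I η) = -η`, this is `η = -I c`. -/
def eta (p : M) (u : TangentSpace I p) : ℝ := -S.actJ S.lineComponent p u

/-- The one-form `I d*ω`, which represents the `W₄`-part of the intrinsic torsion. -/
def actCodiffOmega (p : M) (u : TangentSpace I p) : ℝ :=
  S.actJ (codiff₂ S.metric S.omega) p u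

/-- The `SU(n)`-structure `(e^{2f} ⟨·,·⟩, J, e^{nf} Ψ)` obtained from `(⟨·,·⟩, J, Ψ)` by a
conformal change of the metric. -/
def conformalChange (f : M → ℝ) (hf : CMDiff ∞ f) : SpecialAlmostHermitian n I M where
  dim_eq := S.dim_eq
  metric := conformalMetric S.metric f hf
  J := S.J
  J_smooth := S.J_smooth
  J_sq := S.J_sq
  J_orthogonal p v w := by simp [conformalMetric, S.J_orthogonal]
  Psi p := Real.exp (n * f p) • S.Psi p
  Psi_smooth p V hV := by
    have h1 : CMDiffAt ∞ (fun q => Real.exp (n * f q)) p :=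
      (Real.contDiff_exp.contMDiff.comp (contMDiff_const.mul hf)).contMDiffAt
    exact h1.smul (S.Psi_smooth p V hV)
  Psi_complexLinear p v i := by
    simp only [ContinuousAlternatingMap.smul_apply, S.Psi_complexLinear]
    rw [mul_smul_comm]
  Psi_normalized p u hu := by
    have h2 : Real.exp (2 * f p) = Real.exp (f p) * Real.exp (f p) := by
      rw [← Real.exp_add]; ring_nf
    have h3 : Real.exp (n * f p) = Real.exp (f p) ^ n := Real.exp_nat_mul _ _
    refine Eq.trans ?_ (S.Psi_normalized p (fun i => Real.exp (f p) • u i) ?_)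
    · refine congrArg ((1 / (n.factorial : ℂ)) * ·) (Finset.sum_congr rfl fun k _ => ?_)
      have h4 : S.Psi p (fun a => Real.exp (f p) • u (k a))
          = Real.exp (f p) ^ n • S.Psi p (fun a => u (k a)) := by
        have := (S.Psi p).toMultilinearMap.map_smul_univ (fun _ => Real.exp (f p))
          (fun a => u (k a))
        simp only [Finset.prod_const, Finset.card_univ, Fintype.card_fin] at this
        exact this
      rw [h4, ContinuousAlternatingMap.smul_apply, h3]
    · intro i j
      rw [← hu i j]
      simp only [conformalMetric, map_smul, FunLike.coe_smul, Pi.smul_apply, smul_eq_mul, h2]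
      push_cast
      ring

end SpecialAlmostHermitian

end SpecialAlmostHermitianStructures

end SpecialHermitian

set_option linter.unusedSectionVars false

namespace SpecialHermitian

section HermitianLinearAlgebra

variable {V : Type*} [AddCommGroup V] [Module ℝ V] [TopologicalSpace V]
  {g : V →L[ℝ] V →L[ℝ] ℝ} {J : V →L[ℝ] V} {n : ℕ}

/-- `g` is an inner product and `J` is a `g`-orthogonal complex structure. -/
structure IsHermitianPair (g : V →L[ℝ] V →L[ℝ] ℝ) (J : V →L[ℝ] V) : Prop where
  symm : ∀ v w, g v w = g w v
  pos : ∀ v, v ≠ 0 → 0 < g v v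
  sq : ∀ v, J (J v) = -v
  orth : ∀ v w, g (J v) (J w) = g v w

/-- `u` is unitary for the Hermitian form `g(x, y) + i g(x, J y)`. -/
structure IsUnitaryFrame (g : V →L[ℝ] V →L[ℝ] ℝ) (J : V →L[ℝ] V) (u : Fin n → V) : Prop where
  inner_eq : ∀ i j, g (u i) (u j) = if i = j then 1 else 0
  inner_J_eq : ∀ i j, g (u i) (J (u j)) = 0

namespace IsHermitianPair

variable (h : IsHermitianPair g J)
include h

lemma inner_J_left (v w : V) : g (J v) w = -g v (J w) := by
  have := h.orth v (J w)
  rw [h.sq, map_neg] at this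
  linarith

lemma inner_J_self (v : V) : g v (J v) = 0 := by
  have := h.inner_J_left v v
  rw [h.symm] at this
  linarith

lemma exists_unitaryFrame_of_le [FiniteDimensional ℝ V] (hd : Module.finrank ℝ V = 2 * n) :
    ∀ k ≤ n, ∃ u : Fin k → V, IsUnitaryFrame g J u := by
  intro k
  induction k with
  | zero => exact fun _ => ⟨Fin.elim0, ⟨fun i => i.elim0, fun i => i.elim0⟩⟩
  | succ k ih =>
    intro hk
    obtain ⟨u, hu⟩ := ih (by omega)
    let L : V →ₗ[ℝ] (Fin k ⊕ Fin k → ℝ) := LinearMap.pi fun s =>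
      Sum.elim (fun i => (g (u i) : V →ₗ[ℝ] ℝ)) (fun i => (g (J (u i)) : V →ₗ[ℝ] ℝ)) s
    have hL : LinearMap.ker L ≠ ⊥ := by
      apply LinearMap.ker_ne_bot_of_finrank_lt
      simp [hd]
      omega
    obtain ⟨w, hw, hw0⟩ := Submodule.exists_mem_ne_zero_of_ne_bot hL
    have hw1 : ∀ i, g (u i) w = 0 := fun i => congrFun (LinearMap.mem_ker.1 hw) (Sum.inl i)
    have hw2 : ∀ i, g (J (u i)) w = 0 := fun i => congrFun (LinearMap.mem_ker.1 hw) (Sum.inr i)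
    have hp := h.pos w hw0
    set r := (Real.sqrt (g w w))⁻¹ with hr
    have hrr : r * (r * g w w) = 1 := by
      rw [hr, ← mul_assoc, ← mul_inv, Real.mul_self_sqrt hp.le, inv_mul_cancel₀ hp.ne']
    refine ⟨Fin.snoc u (r • w), ⟨fun i j => ?_, fun i j => ?_⟩⟩
    · refine Fin.lastCases ?_ (fun i => ?_) i <;> refine Fin.lastCases ?_ (fun j => ?_) j
      · simp [hrr]
      · simp [h.symm w, hw1, (Fin.castSucc_lt_last j).ne']
      · simp [hw1, (Fin.castSucc_lt_last i).ne]
      · simp [hu.inner_eq]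
    · refine Fin.lastCases ?_ (fun i => ?_) i <;> refine Fin.lastCases ?_ (fun j => ?_) j
      · simp [h.inner_J_self]
      · simp [h.symm w, hw2]
      · have := h.inner_J_left (u i) w
        rw [hw2] at this
        simp [← neg_eq_iff_eq_neg.2 this]
      · simp [hu.inner_J_eq]

lemma exists_unitaryFrame [FiniteDimensional ℝ V] (hd : Module.finrank ℝ V = 2 * n) :
    ∃ u : Fin n → V, IsUnitaryFrame g J u := h.exists_unitaryFrame_of_le hd n le_rfl

end IsHermitianPair

/-- The complex coordinates `g(x, u_j) + i g(x, J u_j)` of `x` in the frame `u`. -/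
noncomputable def frameCoord (g : V →L[ℝ] V →L[ℝ] ℝ) (J : V →L[ℝ] V) (u : Fin n → V) (x : V) :
    Fin n → ℂ :=
  fun j => (g x (u j) : ℂ) + Complex.I * g x (J (u j))

/-- The real vector with given complex coordinates. -/
def frameVector (J : V →L[ℝ] V) (u : Fin n → V) (z : Fin n → ℂ) : V :=
  ∑ j, ((z j).re • u j + (z j).im • J (u j))

namespace IsUnitaryFrame

variable {u : Fin n → V} (hu : IsUnitaryFrame g J u) (h : IsHermitianPair g J)
include hu h

/-- The orthonormal basis `u_1, …, u_n, J u_1, …, J u_n`. -/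
noncomputable def basis (hd : Module.finrank ℝ V = 2 * n) [FiniteDimensional ℝ V] :
    Module.Basis (Fin n ⊕ Fin n) ℝ V :=
  basisOfLinearIndependentOfCardEqFinrank' (Sum.elim u fun i => J (u i)) (by
    rw [Fintype.linearIndependent_iff]
    intro c hc s
    have hc' := congrArg (fun x => g x (Sum.elim u (fun i => J (u i)) s)) hc
    cases s <;>
    simpa [Fintype.sum_sum_type, hu.inner_eq, hu.inner_J_eq, h.orth, h.symm (J _) (u _)] using hc')
    (by simp [hd, two_mul])

variable (hd : Module.finrank ℝ V = 2 * n) [FiniteDimensional ℝ V]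

lemma coe_basis : ⇑(hu.basis h hd) = Sum.elim u fun i => J (u i) := by
  simp [basis]

lemma inner_basis (s t : Fin n ⊕ Fin n) :
    g (hu.basis h hd s) (hu.basis h hd t) = if s = t then 1 else 0 := by
  rw [coe_basis]
  cases s <;> cases t <;>
  simp [hu.inner_eq, hu.inner_J_eq, h.orth, h.symm (J _) (u _)]

lemma basis_repr (x : V) (s : Fin n ⊕ Fin n) :
    (hu.basis h hd).repr x s = g x (hu.basis h hd s) := by
  have := congrArg (fun y => g y (hu.basis h hd s)) ((hu.basis h hd).sum_repr x)
  rcases s <;> simpa [-Module.Basis.sum_repr, map_sum, hu.inner_basis h hd] using this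

include hd in
lemma sum_repr (x : V) : ∑ j, (g x (u j) • u j + g x (J (u j)) • J (u j)) = x := by
  have := (hu.basis h hd).sum_repr x
  simp only [hu.basis_repr h hd, coe_basis, Fintype.sum_sum_type, Sum.elim_inl,
    Sum.elim_inr] at this
  rw [Finset.sum_add_distrib, this]

include hd in
lemma frameVector_frameCoord (x : V) : frameVector J u (frameCoord g J u x) = x := by
  simpa [frameVector, frameCoord] using hu.sum_repr h hd x

omit h [FiniteDimensional ℝ V] in
lemma frameCoord_frame (i : Fin n) : frameCoord g J u (u i) = Pi.single i 1 := by
  ext j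
  simp only [frameCoord, hu.inner_eq, hu.inner_J_eq, Pi.single_apply, eq_comm]
  split_ifs <;> simp

include hd in
lemma inner_eq_sum (x y : V) :
    g x y = ∑ j, (g x (u j) * g y (u j) + g x (J (u j)) * g y (J (u j))) := by
  conv_lhs => rw [← hu.sum_repr h hd x]
  simp [map_sum, h.symm _ y]

include hd in
/-- The Hermitian form in unitary coordinates. -/
lemma hermitian_eq_sum (x y : V) :
    (g x y : ℂ) + Complex.I * g x (J y) =
      ∑ j, frameCoord g J u x j * (starRingEnd ℂ) (frameCoord g J u y j) := by
  rw [hu.inner_eq_sum h hd x y, hu.inner_eq_sum h hd x (J y)]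
  push_cast
  rw [Finset.mul_sum, ← Finset.sum_add_distrib]
  refine Finset.sum_congr rfl fun j _ => ?_
  simp only [frameCoord, h.inner_J_left y, map_add, map_mul, Complex.conj_I,
    Complex.conj_ofReal, h.sq, map_neg]
  push_cast
  linear_combination ((g x (J (u j)) : ℂ) * (g y (J (u j)) : ℂ)) * Complex.I_mul_I

include hd in
lemma trace_eq_sum (A : Module.End ℝ V) : LinearMap.trace ℝ V A =
    ∑ j, (g (A (u j)) (u j) + g (A (J (u j))) (J (u j))) := by
  rw [LinearMap.trace_eq_matrix_trace ℝ (hu.basis h hd), Matrix.trace, Fintype.sum_sum_type,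
    Finset.sum_add_distrib]
  simp [LinearMap.toMatrix_apply, hu.basis_repr h hd, coe_basis]

include hd in
lemma neg_trace_mul_J {A : Module.End ℝ V} (hA : ∀ v w, g (A v) w + g v (A w) = 0) :
    -LinearMap.trace ℝ V (A * (J : V →ₗ[ℝ] V)) = 2 * ∑ j, g (A (u j)) (J (u j)) := by
  rw [hu.trace_eq_sum h hd, Finset.mul_sum, ← Finset.sum_neg_distrib]
  refine Finset.sum_congr rfl fun j _ => ?_
  have := hA (J (u j)) (u j)
  rw [h.symm (J (u j))] at this
  simp [h.sq]
  linarith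

end IsUnitaryFrame

section ComplexForms

/-- Alternating forms that are complex linear with respect to `J`. -/
def IsComplexLinearForm (J : V →L[ℝ] V) (T : V [⋀^Fin n]→ₗ[ℝ] ℂ) : Prop :=
  ∀ v i, T (Function.update v i (J (v i))) = Complex.I * T v

lemma frameVector_add (u : Fin n → V) (z w : Fin n → ℂ) :
    frameVector J u (z + w) = frameVector J u z + frameVector J u w := by
  simp only [frameVector, ← Finset.sum_add_distrib]
  refine Finset.sum_congr rfl fun j _ => ?_
  simp [add_smul]
  abel

lemma IsHermitianPair.frameVector_smul (h : IsHermitianPair g J) (u : Fin n → V) (c : ℂ)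
    (z : Fin n → ℂ) :
    frameVector J u (c • z) = c.re • frameVector J u z + c.im • J (frameVector J u z) := by
  simp only [frameVector, map_sum, Finset.smul_sum, ← Finset.sum_add_distrib]
  refine Finset.sum_congr rfl fun j _ => ?_
  simp [h.sq]
  module

/-- A complex linear form read in the frame `u`. -/
noncomputable def IsComplexLinearForm.pullback {T : V [⋀^Fin n]→ₗ[ℝ] ℂ}
    (hT : IsComplexLinearForm J T) (h : IsHermitianPair g J) (u : Fin n → V) :
    (Fin n → ℂ) [⋀^Fin n]→ₗ[ℂ] ℂ where
  toFun z := T fun i => frameVector J u (z i)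
  map_update_add' {d} z i x y := by
    obtain rfl : d = instDecidableEqFin n := Subsingleton.elim _ _
    have key : ∀ w, (fun k => frameVector J u (Function.update z i w k)) =
        Function.update (fun k => frameVector J u (z k)) i (frameVector J u w) := fun w => by
      ext1 k
      by_cases hk : k = i
      · subst hk; simp
      · simp [hk]
    rw [key, key, key, frameVector_add,
      T.map_update_add]
  map_update_smul' {d} z i c x := by
    obtain rfl : d = instDecidableEqFin n := Subsingleton.elim _ _
    have key : ∀ w, (fun k => frameVector J u (Function.update z i w k)) =
        Function.update (fun k => frameVector J u (z k)) i (frameVector J u w) := fun w => by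
      ext1 k
      by_cases hk : k = i
      · subst hk; simp
      · simp [hk]
    have hJ := hT (Function.update (fun k => frameVector J u (z k)) i (frameVector J u x)) i
    simp only [Function.update_self, Function.update_idem] at hJ
    rw [key, key, h.frameVector_smul,
      T.map_update_add, T.map_update_smul, T.map_update_smul, hJ]
    simp only [Complex.real_smul, smul_eq_mul]
    linear_combination
      T (Function.update (fun k => frameVector J u (z k)) i (frameVector J u x)) *
        Complex.re_add_im c
  map_eq_zero_of_eq' z i j hz hij := T.map_eq_zero_of_eq _ (by simp [hz]) hij

variable {T : V [⋀^Fin n]→ₗ[ℝ] ℂ} {u : Fin n → V}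

lemma IsComplexLinearForm.eq_mul_det (hT : IsComplexLinearForm J T) (h : IsHermitianPair g J)
    (hu : IsUnitaryFrame g J u) (hd : Module.finrank ℝ V = 2 * n) [FiniteDimensional ℝ V]
    (v : Fin n → V) :
    T v = T u * (Matrix.of fun i j => frameCoord g J u (v i) j).det := by
  have e := (hT.pullback h u).eq_smul_basis_det (Pi.basisFun ℂ (Fin n))
  have e1 := congrArg (fun f => f fun i => frameCoord g J u (v i)) e
  have e2 : (hT.pullback h u) (Pi.basisFun ℂ (Fin n)) = T u := by
    change T _ = T u
    congr 1
    ext1 i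
    simp [← hu.frameCoord_frame i, hu.frameVector_frameCoord h hd]
  rw [e2] at e1
  have e3 : (hT.pullback h u) (fun i => frameCoord g J u (v i)) = T v := by
    change T _ = T v
    simp [hu.frameVector_frameCoord h hd]
  rw [← e3, e1]
  simp [Pi.basisFun_det]
  left; rfl

lemma IsComplexLinearForm.map_update (hT : IsComplexLinearForm J T) (h : IsHermitianPair g J)
    (hu : IsUnitaryFrame g J u) (hd : Module.finrank ℝ V = 2 * n) [FiniteDimensional ℝ V]
    (i : Fin n) (x : V) :
    T (Function.update u i x) = frameCoord g J u x i * T u := by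
  rw [hT.eq_mul_det h hu hd, mul_comm]
  congr 1
  have : (Matrix.of fun k j => frameCoord g J u (Function.update u i x k) j) =
      (1 : Matrix (Fin n) (Fin n) ℂ).updateRow i (frameCoord g J u x) := by
    ext k j
    by_cases hk : k = i
    · subst hk; simp
    · simp [hk, hu.frameCoord_frame, Matrix.one_apply, Pi.single_apply, eq_comm]
  rw [this, ← Matrix.cramer_transpose_apply]
  simp

lemma IsComplexLinearForm.sum_update_skew (hT : IsComplexLinearForm J T)
    (h : IsHermitianPair g J) (hu : IsUnitaryFrame g J u) (hd : Module.finrank ℝ V = 2 * n)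
    [FiniteDimensional ℝ V] {A : V → V} (hA : ∀ v w, g (A v) w + g v (A w) = 0) :
    ∑ i, T (Function.update u i (A (u i))) =
      Complex.I * ((∑ i, g (A (u i)) (J (u i)) : ℝ) : ℂ) * T u := by
  push_cast
  rw [Finset.mul_sum, Finset.sum_mul]
  refine Finset.sum_congr rfl fun i _ => ?_
  have := hA (u i) (u i)
  rw [h.symm (u i)] at this
  have h0 : g (A (u i)) (u i) = 0 := by linarith
  rw [hT.map_update h hu hd]
  simp [frameCoord, h0]

lemma IsComplexLinearForm.mul_comm_of (hT : IsComplexLinearForm J T)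
    {T' : V [⋀^Fin n]→ₗ[ℝ] ℂ} (hT' : IsComplexLinearForm J T') (h : IsHermitianPair g J)
    (hu : IsUnitaryFrame g J u) (hd : Module.finrank ℝ V = 2 * n) [FiniteDimensional ℝ V]
    (v : Fin n → V) : T' v * T u = T' u * T v := by
  rw [hT.eq_mul_det h hu hd v, hT'.eq_mul_det h hu hd v]
  ring

/-- The square of the norm of a complex volume form is a Gram determinant. -/
lemma IsComplexLinearForm.mul_conj (hT : IsComplexLinearForm J T) (h : IsHermitianPair g J)
    (hu : IsUnitaryFrame g J u) (hd : Module.finrank ℝ V = 2 * n) [FiniteDimensional ℝ V]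
    (v : Fin n → V) :
    T v * (starRingEnd ℂ) (T v) = T u * (starRingEnd ℂ) (T u) *
      (Matrix.of fun i j => (g (v i) (v j) : ℂ) + Complex.I * g (v i) (J (v j))).det := by
  set Z := (Matrix.of fun i j => frameCoord g J u (v i) j) with hZ
  have : (Matrix.of fun i j => (g (v i) (v j) : ℂ) + Complex.I * g (v i) (J (v j))) =
      Z * Z.conjTranspose := by
    ext i j
    simp [hu.hermitian_eq_sum h hd, Matrix.mul_apply, hZ]
  rw [this, Matrix.det_mul, Matrix.det_conjTranspose, hT.eq_mul_det h hu hd, map_mul, ← hZ,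
    starRingEnd_apply, starRingEnd_apply]
  ring

omit [TopologicalSpace V] in
lemma sum_mul_conj_comp (T : V [⋀^Fin n]→ₗ[ℝ] ℂ) (u : Fin n → V) :
    ∑ k : Fin n → Fin n, T (fun a => u (k a)) * (starRingEnd ℂ) (T fun a => u (k a)) =
      n.factorial * (T u * (starRingEnd ℂ) (T u)) := by
  have : ∑ σ : Equiv.Perm (Fin n), T u * (starRingEnd ℂ) (T u) =
      ∑ k : Fin n → Fin n, T (fun a => u (k a)) * (starRingEnd ℂ) (T fun a => u (k a)) := by
    refine Fintype.sum_of_injective (fun σ : Equiv.Perm (Fin n) => (σ : Fin n → Fin n))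
      DFunLike.coe_injective _ _ (fun k hk => ?_) fun σ => ?_
    · have : ¬ Function.Injective k := fun hi => hk
        ⟨Equiv.ofBijective k (Finite.injective_iff_bijective.1 hi), rfl⟩
      simp only [Function.Injective, not_forall] at this
      obtain ⟨a, b, hab, hne⟩ := this
      rw [T.map_eq_zero_of_eq (fun a => u (k a)) (by simp [hab]) hne]
      simp
    · have := T.map_perm u σ
      simp only [Function.comp_def] at this
      rw [this]
      rcases Int.units_eq_one_or (Equiv.Perm.sign σ) with hs | hs <;> simp [hs]
  rw [← this]
  simp [Fintype.card_perm]

end ComplexForms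

end HermitianLinearAlgebra

section Derivatives

variable {E : Type*} [NormedAddCommGroup E] [NormedSpace ℝ E]
  {H : Type*} [TopologicalSpace H] {I : ModelWithCorners ℝ E H}
  {M : Type*} [TopologicalSpace M] [ChartedSpace H M]
  {F F' : Type*} [NormedAddCommGroup F] [NormedSpace ℝ F]
  [NormedAddCommGroup F'] [NormedSpace ℝ F']

lemma mdifferentiableAt_comp {φ : F → F'} {f : M → F} {p : M} (hφ : DifferentiableAt ℝ φ (f p))
    (hf : MDiffAt f p) : MDiffAt (fun q => φ (f q)) p :=
  hφ.mdifferentiableAt.comp p hf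

lemma mvfderiv_comp_apply' {φ : F → F'} {φ' : F →L[ℝ] F'} {f : M → F} {p : M}
    (hφ : HasFDerivAt φ φ' (f p)) (hf : MDiffAt f p) (u : TangentSpace I p) :
    d% (fun q => φ (f q)) p u = φ' (d% f p u) := by
  have := mfderiv_comp p hφ.differentiableAt.mdifferentiableAt hf
  rw [mfderiv_eq_fderiv, hφ.fderiv] at this
  exact congrArg (fun L : TangentSpace I p →L[ℝ] F' => L u) this

lemma mvfderiv_clm {f : M → F} {p : M} (L : F →L[ℝ] F') (hf : MDiffAt f p)
    (u : TangentSpace I p) : d% (fun q => L (f q)) p u = L (d% f p u) :=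
  mvfderiv_comp_apply' L.hasFDerivAt hf u

end Derivatives

/-- The derivative of the determinant at the identity is the trace. -/
lemma exists_hasFDerivAt_det_one (n : ℕ) :
    ∃ L : (Fin n → Fin n → ℂ) →L[ℝ] ℂ, (∀ z, L z = ∑ i, z i i) ∧
      HasFDerivAt (fun z : Fin n → Fin n → ℂ => (Matrix.of z).det) L
        (fun i j => (1 : Matrix (Fin n) (Fin n) ℂ) i j) := by
  have hc : Continuous fun z : Fin n → Fin n → ℂ =>
      (Matrix.detRowAlternating (n := Fin n) (R := ℂ)).toMultilinearMap z :=
    Continuous.matrix_det (A := fun z : Fin n → Fin n → ℂ => Matrix.of z) continuous_id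
  let f : ContinuousMultilinearMap ℂ (fun _ : Fin n => Fin n → ℂ) ℂ :=
    ⟨(Matrix.detRowAlternating (n := Fin n) (R := ℂ)).toMultilinearMap, hc⟩
  refine ⟨(f.linearDeriv fun i j => (1 : Matrix (Fin n) (Fin n) ℂ) i j).restrictScalars ℝ,
    fun z => ?_,
    (f.hasFDerivAt fun i j => (1 : Matrix (Fin n) (Fin n) ℂ) i j).restrictScalars ℝ⟩
  rw [ContinuousLinearMap.coe_restrictScalars', ContinuousMultilinearMap.linearDeriv_apply]
  refine Finset.sum_congr rfl fun i _ => ?_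
  change ((1 : Matrix (Fin n) (Fin n) ℂ).updateRow i (z i)).det = z i i
  rw [← Matrix.cramer_transpose_apply]
  simp

lemma mdifferentiableAt_pi_of_forall {E : Type*} [NormedAddCommGroup E] [NormedSpace ℝ E]
    {H : Type*} [TopologicalSpace H] {I : ModelWithCorners ℝ E H} {M : Type*} [TopologicalSpace M]
    [ChartedSpace H M] {ι : Type*} [Fintype ι] {F : Type*} [NormedAddCommGroup F]
    [NormedSpace ℝ F] {f : ι → M → F} {p : M} (h : ∀ i, MDifferentiableAt I 𝓘(ℝ, F) (f i) p) :
    MDifferentiableAt I 𝓘(ℝ, ι → F) (fun q i => f i q) p := by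
  simp only [mdifferentiableAt_iff] at h ⊢
  exact ⟨continuousAt_pi.2 fun i => (h i).1, differentiableWithinAt_pi.2 fun i => (h i).2⟩

section Manifold

variable {E : Type*} [NormedAddCommGroup E] [NormedSpace ℝ E] [FiniteDimensional ℝ E]
  {H : Type*} [TopologicalSpace H] {I : ModelWithCorners ℝ E H}
  {M : Type*} [TopologicalSpace M] [ChartedSpace H M] [IsManifold I ∞ M]

instance tangentSpace_finiteDimensional (p : M) : FiniteDimensional ℝ (TangentSpace I p) :=
  inferInstanceAs (FiniteDimensional ℝ E)

instance tangentSpace_t2Space (p : M) : T2Space (TangentSpace I p) :=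
  inferInstanceAs (T2Space E)

lemma mdiffAt_extend {p : M} (v : TangentSpace I p) :
    MDiffAt (T% (FiberBundle.extend E v : Π q : M, TangentSpace I q)) p :=
  FiberBundle.mdifferentiableAt_extend I E (V := fun p : M => TangentSpace I p) v

lemma cmdiffAt_extend {p : M} (v : TangentSpace I p) :
    CMDiffAt ∞ (T% (FiberBundle.extend E v : Π q : M, TangentSpace I q)) p :=
  FiberBundle.contMDiffAt_extend I E (V := fun p : M => TangentSpace I p) v

namespace SpecialAlmostHermitian

variable {n : ℕ} (S : SpecialAlmostHermitian n I M)

lemma hermitian (p : M) : IsHermitianPair (S.metric.inner p) (S.J p) where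
  symm := S.metric.symm p
  pos := S.metric.pos p
  sq := S.J_sq p
  orth := S.J_orthogonal p

include S in
lemma finrank_tangentSpace (p : M) : Module.finrank ℝ (TangentSpace I p) = 2 * n := S.dim_eq

lemma exists_unitaryFrame (p : M) :
    ∃ u : Fin n → TangentSpace I p, IsUnitaryFrame (S.metric.inner p) (S.J p) u :=
  (S.hermitian p).exists_unitaryFrame (S.finrank_tangentSpace p)

/-- `Ψ` as an algebraic alternating form. -/
noncomputable def psiForm (p : M) : (TangentSpace I p) [⋀^Fin n]→ₗ[ℝ] ℂ :=
  (S.Psi p).toAlternatingMap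

@[simp] lemma psiForm_apply (p : M) (v : Fin n → TangentSpace I p) :
    S.psiForm p v = S.Psi p v := rfl

lemma psiForm_complexLinear (p : M) : IsComplexLinearForm (S.J p) (S.psiForm p) :=
  S.Psi_complexLinear p

lemma psi_mul_conj {p : M} {u : Fin n → TangentSpace I p}
    (hu : IsUnitaryFrame (S.metric.inner p) (S.J p) u) :
    S.Psi p u * (starRingEnd ℂ) (S.Psi p u) = 1 := by
  have h1 := S.Psi_normalized p u fun i j => by
    rw [hu.inner_eq, hu.inner_J_eq]
    split_ifs <;> simp
  have h2 := sum_mul_conj_comp (S.psiForm p) u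
  simp only [psiForm_apply] at h2
  rw [h2, ← mul_assoc, one_div, inv_mul_cancel₀ (by exact_mod_cast n.factorial_ne_zero),
    one_mul] at h1
  exact h1

lemma psi_ne_zero {p : M} {u : Fin n → TangentSpace I p}
    (hu : IsUnitaryFrame (S.metric.inner p) (S.J p) u) : S.Psi p u ≠ 0 := by
  intro h
  simpa [h] using S.psi_mul_conj hu

/-- `Ψ` evaluated on differentiable vector fields is differentiable. -/
lemma mdiffAt_psi {p : M} {V : Fin n → Π q : M, TangentSpace I q}
    (hV : ∀ i, MDiffAt (T% (V i)) p) :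
    MDifferentiableAt I 𝓘(ℝ, ℂ) (fun q => S.Psi q fun i => V i q) p := by
  let t := trivializationAt E (fun q : M => TangentSpace I q) p
  have p_mem : p ∈ t.baseSet := FiberBundle.mem_baseSet_trivializationAt E _ p
  let b := Module.finBasis ℝ E
  let s := t.localFrame b
  let c := t.localFrameCoeff I b
  have hs (i) : CMDiffAt ∞ (T% (s i)) p := contMDiffAt_localFrame_of_mem ∞ _ b i p_mem
  have hc (i j) : MDiffAt (LinearMap.piApply (c j) (V i)) p :=
    mdifferentiableAt_localFrameCoeff b p_mem (hV i) j
  have hev : ∀ᶠ q in nhds p, (S.Psi q fun i => V i q) =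
      (∑ k : Fin n → Fin (Module.finrank ℝ E), fun q =>
        (∏ i, LinearMap.piApply (c (k i)) (V i)) q • S.Psi q fun i => s (k i) q) q := by
    have h1 : ∀ᶠ q in nhds p, ∀ i, V i q = ∑ j, c j q (V i q) • s j q :=
      Filter.eventually_all.2 fun i => t.eventually_eq_localFrame_sum_coeff_smul b p_mem
    filter_upwards [h1] with q hq
    have h2 : (fun i => V i q) = fun i => ∑ j, c j q (V i q) • s j q := funext hq
    rw [h2, Finset.sum_apply]
    refine ((S.Psi q).toMultilinearMap.map_sum fun i j => c j q (V i q) • s j q).trans ?_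
    refine Finset.sum_congr rfl fun k _ => ?_
    rw [Finset.prod_apply]
    exact (S.Psi q).toMultilinearMap.map_smul_univ (fun i => c (k i) q (V i q)) fun i => s (k i) q
  refine MDifferentiableAt.congr_of_eventuallyEq ?_ hev
  refine MDifferentiableAt.sum fun k _ => ?_
  refine MDifferentiableAt.smul
    (MDifferentiableAt.prod (t := Finset.univ) fun i _ => hc i (k i)) ?_
  exact (S.Psi_smooth p (fun i => s (k i)) fun i => hs (k i)).mdifferentiableAt (by simp)

/-- The covariant derivative `u (Ψ(V_1, …, V_n)) - ∑ i, Ψ(V_1, …, D_u V_i, …, V_n)`. -/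
noncomputable def covPsi (D : Connection I M) (V : Fin n → Π q : M, TangentSpace I q) (p : M)
    (u : TangentSpace I p) : ℂ :=
  mvfderiv I (fun q => S.Psi q fun i => V i q) p u
    - ∑ i, S.Psi p (Function.update (fun j => V j p) i (D (V i) p u))

variable (D : Connection I M)

omit [IsManifold I ∞ M] [FiniteDimensional ℝ E] in
lemma update_field_apply (V : Fin n → Π q : M, TangentSpace I q) (i : Fin n)
    (W : Π q : M, TangentSpace I q) (q : M) :
    (fun j => Function.update V i W j q) = Function.update (fun j => V j q) i (W q) := by
  ext1 j
  by_cases hj : j = i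
  · subst hj; simp
  · simp [hj]

lemma mdiffAt_update {p : M} {V : Fin n → Π q : M, TangentSpace I q}
    (hV : ∀ i, MDiffAt (T% (V i)) p) (i : Fin n) {W : Π q : M, TangentSpace I q}
    (hW : MDiffAt (T% W) p) (j : Fin n) : MDiffAt (T% (Function.update V i W j)) p := by
  by_cases hj : j = i
  · subst hj; simpa using hW
  · simpa [hj] using hV j

lemma sum_psi_update_update (D : Connection I M) (V : Fin n → Π q : M, TangentSpace I q) (p : M)
    (u : TangentSpace I p) (i : Fin n) (W : Π q : M, TangentSpace I q) :
    ∑ j, S.Psi p (Function.update (fun k => Function.update V i W k p) j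
        (D (Function.update V i W j) p u)) =
      S.Psi p (Function.update (fun k => V k p) i (D W p u)) +
      ∑ j ∈ Finset.univ.erase i,
        S.Psi p (Function.update (Function.update (fun k => V k p) j (D (V j) p u)) i (W p)) := by
  rw [← Finset.add_sum_erase _ _ (Finset.mem_univ i)]
  congr 1
  · simp [update_field_apply]
  · refine Finset.sum_congr rfl fun j hj => ?_
    have hji : j ≠ i := Finset.ne_of_mem_erase hj
    rw [update_field_apply, Function.update_of_ne hji, Function.update_comm hji.symm]

lemma covPsi_tensorial {p : M} {V : Fin n → Π q : M, TangentSpace I q}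
    (hV : ∀ i, MDiffAt (T% (V i)) p) (u : TangentSpace I p) (i : Fin n) :
    TensorialAt I E (fun W => S.covPsi D (Function.update V i W) p u) p where
  smul {f W} hf hW := by
    have hd := S.mdiffAt_psi (mdiffAt_update hV i hW)
    have e : (fun q => S.Psi q fun j => Function.update V i (f • W) j q) =
        f • fun q => S.Psi q fun j => Function.update V i W j q := by
      ext1 q
      simp [update_field_apply]
    simp only [covPsi, sum_psi_update_update]
    rw [e, mvfderiv_smul hf hd, D.isCovariantDerivativeOn.leibniz hW hf (s := Set.univ)]
    simp [update_field_apply, mul_sub]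
    rw [← Finset.mul_sum]
    ring
  add {W W'} hW hW' := by
    have hd := S.mdiffAt_psi (mdiffAt_update hV i hW)
    have hd' := S.mdiffAt_psi (mdiffAt_update hV i hW')
    have e : (fun q => S.Psi q fun j => Function.update V i (W + W') j q) =
        (fun q => S.Psi q fun j => Function.update V i W j q) +
        fun q => S.Psi q fun j => Function.update V i W' j q := by
      ext1 q
      simp [update_field_apply]
    simp only [covPsi, sum_psi_update_update]
    rw [e, mvfderiv_add hd hd', D.isCovariantDerivativeOn.add hW hW' (s := Set.univ)]
    simp [Finset.sum_add_distrib]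
    ring

/-- `covPsi` depends only on the values of the vector fields at the point. -/
lemma covPsi_congr {p : M} {V V' : Fin n → Π q : M, TangentSpace I q}
    (hV : ∀ i, MDiffAt (T% (V i)) p) (hV' : ∀ i, MDiffAt (T% (V' i)) p)
    (h : ∀ i, V i p = V' i p) (u : TangentSpace I p) :
    S.covPsi D V p u = S.covPsi D V' p u := by
  have key : ∀ s : Finset (Fin n), S.covPsi D (s.piecewise V' V) p u = S.covPsi D V p u := by
    intro s
    induction s using Finset.induction_on with
    | empty => simp
    | insert i s hi ih =>
      have hp : ∀ j, MDiffAt (T% (s.piecewise V' V j)) p := fun j => by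
        by_cases hj : j ∈ s
        · simpa [hj] using hV' j
        · simpa [hj] using hV j
      rw [← ih, Finset.piecewise_insert]
      have := (S.covPsi_tensorial D hp u i).pointwise (hV' i) (hV i) (h i).symm
      refine this.trans ?_
      have e : Function.update (s.piecewise V' V) i (V i) = s.piecewise V' V := by
        rw [Function.update_eq_self_iff]
        simp [hi]
      simp only [e]
  simpa using (key Finset.univ).symm

/-- `covPsi` as an alternating form at a point. -/
noncomputable def covPsiForm (p : M) (u : TangentSpace I p) :
    (TangentSpace I p) [⋀^Fin n]→ₗ[ℝ] ℂ where
  toFun v := S.covPsi D (fun i => FiberBundle.extend E (v i)) p u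
  map_update_add' {d} v i x y := by
    obtain rfl : d = instDecidableEqFin n := Subsingleton.elim _ _
    have hv : ∀ j, MDiffAt (T% ((fun i => FiberBundle.extend E (v i) :
      Fin n → Π q : M, TangentSpace I q) j)) p := fun j => mdiffAt_extend _
    have key : ∀ (w : TangentSpace I p) (W : Π q : M, TangentSpace I q), MDiffAt (T% W) p →
        W p = w → S.covPsi D (fun j => FiberBundle.extend E (Function.update v i w j)) p u =
        S.covPsi D (Function.update (fun i => FiberBundle.extend E (v i)) i W) p u := by
      intro w W hW hw
      refine S.covPsi_congr D (fun j => mdiffAt_extend _) (mdiffAt_update hv i hW) (fun j => ?_) u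
      by_cases hj : j = i
      · subst hj; simp [hw]
      · simp [hj]
    rw [key _ (FiberBundle.extend E x + FiberBundle.extend E y)
      (mdifferentiableAt_add_section (mdiffAt_extend x) (mdiffAt_extend y)) (by simp),
      key x _ (mdiffAt_extend x) (by simp), key y _ (mdiffAt_extend y) (by simp)]
    exact (S.covPsi_tensorial D hv u i).add (mdiffAt_extend x) (mdiffAt_extend y)
  map_update_smul' {d} v i c x := by
    obtain rfl : d = instDecidableEqFin n := Subsingleton.elim _ _
    have hv : ∀ j, MDiffAt (T% ((fun i => FiberBundle.extend E (v i) :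
      Fin n → Π q : M, TangentSpace I q) j)) p := fun j => mdiffAt_extend _
    have key : ∀ (w : TangentSpace I p) (W : Π q : M, TangentSpace I q), MDiffAt (T% W) p →
        W p = w → S.covPsi D (fun j => FiberBundle.extend E (Function.update v i w j)) p u =
        S.covPsi D (Function.update (fun i => FiberBundle.extend E (v i)) i W) p u := by
      intro w W hW hw
      refine S.covPsi_congr D (fun j => mdiffAt_extend _) (mdiffAt_update hv i hW) (fun j => ?_) u
      by_cases hj : j = i
      · subst hj; simp [hw]
      · simp [hj]
    have hc : MDiffAt (fun _ : M => c) p := mdifferentiableAt_const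
    rw [key _ ((fun _ : M => c) • FiberBundle.extend E x)
      (hc.smul_section (mdiffAt_extend x)) (by simp), key x _ (mdiffAt_extend x) (by simp)]
    exact (S.covPsi_tensorial D hv u i).smul hc (mdiffAt_extend x)
  map_eq_zero_of_eq' v i j hv hij := by
    have h0 : (fun q => S.Psi q fun i => (FiberBundle.extend E (v i) : Π q : M, TangentSpace I q) q)
        = fun _ => 0 := by
      ext1 q
      exact (S.Psi q).map_eq_zero_of_eq _ (by simp [hv]) hij
    simp only [covPsi, h0, mvfderiv_const, FiberBundle.extend_apply_self]
    have h1 : ∀ a, S.Psi p (Function.update v j a) = -S.Psi p (Function.update v i a) := by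
      intro a
      have := (S.psiForm p).map_swap (Function.update v i a) hij
      rw [← psiForm_apply, ← psiForm_apply, ← this]
      congr 1
      ext1 k
      rcases eq_or_ne k i with rfl | hki
      · simp [hij, hij.symm, hv]
      rcases eq_or_ne k j with rfl | hkj
      · simp
      · simp [hki, hkj, Equiv.swap_apply_of_ne_of_ne]
    rw [← Finset.add_sum_erase _ _ (Finset.mem_univ i),
      ← Finset.add_sum_erase _ _ (Finset.mem_erase.2 ⟨hij.symm, Finset.mem_univ j⟩), h1 _, hv,
      Finset.sum_eq_zero]
    · simp
    · intro k hk
      simp only [Finset.mem_erase] at hk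
      exact (S.Psi p).map_eq_zero_of_eq _ (by simp [hk.1.symm, hk.2.1.symm, hv]) hij

lemma covPsiForm_apply {p : M} {V : Fin n → Π q : M, TangentSpace I q}
    (hV : ∀ i, MDiffAt (T% (V i)) p) (u : TangentSpace I p) :
    S.covPsiForm D p u (fun i => V i p) = S.covPsi D V p u :=
  S.covPsi_congr D (fun _ => mdiffAt_extend _) hV (by simp) u

lemma covPsiForm_extend (p : M) (u : TangentSpace I p) (v : Fin n → TangentSpace I p) :
    S.covPsiForm D p u v = S.covPsi D (fun i => FiberBundle.extend E (v i)) p u := rfl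

lemma covDeriv_psiPlus (p : M) (u : TangentSpace I p) (v : Fin n → TangentSpace I p) :
    covDeriv D S.psiPlus p u v = (S.covPsiForm D p u v).re := by
  have := mvfderiv_clm Complex.reCLM
    (S.mdiffAt_psi (p := p) (V := fun i => FiberBundle.extend E (v i)) fun _ => mdiffAt_extend _) u
  simp only [Complex.reCLM_apply] at this
  simp [covPsiForm_extend, covPsi, covDeriv, psiPlus, this]

lemma covDeriv_psiMinus (p : M) (u : TangentSpace I p) (v : Fin n → TangentSpace I p) :
    covDeriv D S.psiMinus p u v = (S.covPsiForm D p u v).im := by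
  have := mvfderiv_clm Complex.imCLM
    (S.mdiffAt_psi (p := p) (V := fun i => FiberBundle.extend E (v i)) fun _ => mdiffAt_extend _) u
  simp only [Complex.imCLM_apply] at this
  simp [covPsiForm_extend, covPsi, covDeriv, psiMinus, this]

/-- Changing the connection changes the covariant derivative of `Ψ` algebraically. -/
lemma covPsiForm_difference (D' : Connection I M) (p : M) (u : TangentSpace I p)
    (v : Fin n → TangentSpace I p) :
    S.covPsiForm D' p u v = S.covPsiForm D p u v -
      ∑ i, S.Psi p (Function.update v i (D'.difference D p (v i) u)) := by
  have hd : ∀ i, D' (FiberBundle.extend E (v i)) p u =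
      D (FiberBundle.extend E (v i)) p u + D'.difference D p (v i) u := fun i => by
    have := D'.isCovariantDerivativeOnUniv.difference_apply D.isCovariantDerivativeOnUniv
      (x := p) trivial (mdiffAt_extend (v i))
    rw [FiberBundle.extend_apply_self] at this
    simp only [CovariantDerivative.difference, this]
    simp
  simp [covPsiForm_extend, covPsi, hd, Finset.sum_add_distrib]
  ring

end SpecialAlmostHermitian

lemma difference_apply (D' D : Connection I M) {p : M} {W : Π q : M, TangentSpace I q}
    (hW : MDiffAt (T% W) p) (u : TangentSpace I p) :
    D'.difference D p (W p) u = D' W p u - D W p u := by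
  have := D'.isCovariantDerivativeOnUniv.difference_apply D.isCovariantDerivativeOnUniv
    (x := p) trivial hW
  simp only [CovariantDerivative.difference, this]
  simp

lemma difference_addOneForm (D : Connection I M)
    (A : Π p : M, TangentSpace I p →L[ℝ] TangentSpace I p →L[ℝ] TangentSpace I p) (p : M)
    (w u : TangentSpace I p) : (D.addOneForm A).difference D p w u = A p w u := by
  have := difference_apply (D.addOneForm A) D (mdiffAt_extend w) u
  simpa [CovariantDerivative.addOneForm] using this

/-- `D` is compatible with the metric `g`. -/
def IsMetricConnection (g : Metric I M) (D : Connection I M) : Prop :=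
  ∀ (p : M) (u : TangentSpace I p) (Y Z : Π q : M, TangentSpace I q),
    MDiffAt (T% Y) p → MDiffAt (T% Z) p →
    d% (fun q => g.inner q (Y q) (Z q)) p u =
      g.inner p (D Y p u) (Z p) + g.inner p (Y p) (D Z p u)

lemma IsMetricConnection.addOneForm {g : Metric I M} {D : Connection I M}
    (hD : IsMetricConnection g D)
    {A : Π p : M, TangentSpace I p →L[ℝ] TangentSpace I p →L[ℝ] TangentSpace I p}
    (hA : ∀ p u v w, g.inner p (A p v u) w + g.inner p v (A p w u) = 0) :
    IsMetricConnection g (D.addOneForm A) := by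
  intro p u Y Z hY hZ
  rw [hD p u Y Z hY hZ]
  have := hA p u (Y p) (Z p)
  simp only [CovariantDerivative.addOneForm, FunLike.coe_add, Pi.add_apply, map_add]
  linarith

lemma IsMetricConnection.covDeriv_metric {g : Metric I M} {D : Connection I M}
    (hD : IsMetricConnection g D) (p : M) (u : TangentSpace I p)
    (v : Fin 2 → TangentSpace I p) :
    covDeriv D (fun q (v : Fin 2 → TangentSpace I q) => g.inner q (v 0) (v 1)) p u v = 0 := by
  have := hD p u _ _ (mdiffAt_extend (v 0)) (mdiffAt_extend (v 1))
  simp only [FiberBundle.extend_apply_self] at this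
  simp [covDeriv, this]

namespace SpecialAlmostHermitian

variable {n : ℕ} (S : SpecialAlmostHermitian n I M)

lemma mdiffAt_J {p : M} {W : Π q : M, TangentSpace I q} (hW : CMDiffAt ∞ (T% W) p) :
    MDiffAt (T% fun q => S.J q (W q)) p :=
  (S.J_smooth p W hW).mdifferentiableAt (by simp)

lemma isMetricConnection_leviCivita (g : Metric I M) : IsMetricConnection g (leviCivita g) :=
  (leviCivita_spec g).metric

/-- `g(V, (D_u J) W)` is skew-symmetric in `V` and `W`. -/
lemma inner_covJ_skew {D : Connection I M} (hD : IsMetricConnection S.metric D) {p : M}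
    {V W : Π q : M, TangentSpace I q} (hV : CMDiffAt ∞ (T% V) p) (hW : CMDiffAt ∞ (T% W) p)
    (u : TangentSpace I p) :
    S.metric.inner p (V p) (D (fun q => S.J q (W q)) p u - S.J p (D W p u)) =
      -S.metric.inner p (W p) (D (fun q => S.J q (V q)) p u - S.J p (D V p u)) := by
  have h1 := hD p u V _ (hV.mdifferentiableAt (by simp)) (S.mdiffAt_J hW)
  have h2 := hD p u W _ (hW.mdifferentiableAt (by simp)) (S.mdiffAt_J hV)
  have e : (fun q => S.metric.inner q (V q) (S.J q (W q))) =
      -fun q => S.metric.inner q (W q) (S.J q (V q)) := by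
    ext1 q
    rw [Pi.neg_apply, (S.hermitian q).symm (W q), (S.hermitian q).inner_J_left, neg_neg]
  rw [e, mvfderiv_neg] at h1
  simp only [FunLike.coe_neg, Pi.neg_apply] at h1
  have h3 := (S.hermitian p).inner_J_left (D V p u) (W p)
  have h4 := (S.hermitian p).inner_J_left (D W p u) (V p)
  rw [(S.hermitian p).symm _ (W p)] at h3
  rw [(S.hermitian p).symm _ (V p)] at h4
  simp only [map_sub]
  linarith

/-- The covariant derivative of `J`: `w ↦ u ↦ (∇_u J) w`. -/
noncomputable def covJ (p : M) :
    TangentSpace I p →L[ℝ] TangentSpace I p →L[ℝ] TangentSpace I p :=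
  LinearMap.toContinuousLinearMap
    { toFun := fun w =>
        leviCivita S.metric (fun q => S.J q (FiberBundle.extend E w q)) p -
          (S.J p).comp (leviCivita S.metric (FiberBundle.extend E w) p)
      map_add' := fun w w' => by
        ext u
        refine inner_ext S.metric p fun v => ?_
        have h := fun w => S.inner_covJ_skew (isMetricConnection_leviCivita S.metric)
          (cmdiffAt_extend v) (cmdiffAt_extend w) u
        simp only [FiberBundle.extend_apply_self] at h
        rw [(S.hermitian p).symm, (S.hermitian p).symm _ v]
        simp only [FunLike.coe_add, FunLike.coe_sub, Pi.add_apply, Pi.sub_apply,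
          ContinuousLinearMap.comp_apply]
        rw [map_add, h, h, h]
        simp only [map_add, FunLike.coe_add, Pi.add_apply]
        ring
      map_smul' := fun c w => by
        ext u
        refine inner_ext S.metric p fun v => ?_
        have h := fun w => S.inner_covJ_skew (isMetricConnection_leviCivita S.metric)
          (cmdiffAt_extend v) (cmdiffAt_extend w) u
        simp only [FiberBundle.extend_apply_self] at h
        rw [(S.hermitian p).symm, (S.hermitian p).symm _ v]
        simp only [FunLike.coe_smul, FunLike.coe_sub, Pi.smul_apply, Pi.sub_apply,
          ContinuousLinearMap.comp_apply, RingHom.id_apply]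
        rw [map_smul, h, h]
        simp only [map_smul, FunLike.coe_smul, Pi.smul_apply, smul_eq_mul]
        ring }

lemma covJ_apply_extend (p : M) (w u : TangentSpace I p) : S.covJ p w u =
    leviCivita S.metric (fun q => S.J q (FiberBundle.extend E w q)) p u -
      S.J p (leviCivita S.metric (FiberBundle.extend E w) p u) := rfl

lemma covJ_apply {p : M} {W : Π q : M, TangentSpace I q} (hW : CMDiffAt ∞ (T% W) p)
    (u : TangentSpace I p) : S.covJ p (W p) u =
      leviCivita S.metric (fun q => S.J q (W q)) p u - S.J p (leviCivita S.metric W p u) := by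
  refine inner_ext S.metric p fun v => ?_
  have h := fun W hW => S.inner_covJ_skew (isMetricConnection_leviCivita S.metric) (W := W)
    (cmdiffAt_extend v) hW u
  simp only [FiberBundle.extend_apply_self] at h
  rw [covJ_apply_extend, (S.hermitian p).symm, (S.hermitian p).symm _ v, h _ hW,
    h _ (cmdiffAt_extend _), FiberBundle.extend_apply_self]

lemma inner_covJ (p : M) (u v w : TangentSpace I p) :
    S.metric.inner p v (S.covJ p w u) = -S.metric.inner p w (S.covJ p v u) := by
  have h := S.inner_covJ_skew (isMetricConnection_leviCivita S.metric)
    (cmdiffAt_extend v) (cmdiffAt_extend w) u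
  simpa only [FiberBundle.extend_apply_self, covJ_apply_extend] using h

lemma covJ_J (p : M) (u w : TangentSpace I p) :
    S.covJ p (S.J p w) u = -S.J p (S.covJ p w u) := by
  have h1 := S.covJ_apply (S.J_smooth p _ (cmdiffAt_extend w)) u
  have h2 : (fun q => S.J q (S.J q (FiberBundle.extend E w q))) =
      (-1 : ℝ) • (FiberBundle.extend E w : Π q : M, TangentSpace I q) := by
    ext1 q
    simp [S.J_sq]
  have h3 := (leviCivita S.metric).isCovariantDerivativeOnUniv.smul_const (-1 : ℝ)
    (mdiffAt_extend w)
  rw [h2, h3] at h1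
  simp only [FiberBundle.extend_apply_self] at h1
  rw [h1, covJ_apply_extend]
  simp [S.J_sq, sub_eq_add_neg]

/-- The Hermitian connection `∇ - ½ J (∇ J)`. -/
noncomputable def hermitianConnection : Connection I M :=
  (leviCivita S.metric).addOneForm fun p =>
    (-(1 / 2) : ℝ) • ((ContinuousLinearMap.postcomp (TangentSpace I p) (S.J p)).comp (S.covJ p))

lemma hermitianConnection_apply (W : Π q : M, TangentSpace I q) (p : M) (u : TangentSpace I p) :
    S.hermitianConnection W p u =
      leviCivita S.metric W p u + (-(1 / 2) : ℝ) • S.J p (S.covJ p (W p) u) := rfl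

lemma isMetricConnection_hermitianConnection :
    IsMetricConnection S.metric S.hermitianConnection := by
  refine (isMetricConnection_leviCivita S.metric).addOneForm fun p u v w => ?_
  have h := S.hermitian p
  have h1 := h.inner_J_left (S.covJ p v u) w
  have h2 := S.inner_covJ p u (S.J p w) v
  rw [S.covJ_J, map_neg, neg_neg, h.symm] at h2
  change S.metric.inner p ((-(1 / 2) : ℝ) • S.J p (S.covJ p v u)) w +
    S.metric.inner p v ((-(1 / 2) : ℝ) • S.J p (S.covJ p w u)) = 0
  simp only [map_smul, FunLike.coe_smul, Pi.smul_apply, smul_eq_mul]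
  linarith

lemma hermitianConnection_J {p : M} {W : Π q : M, TangentSpace I q} (hW : CMDiffAt ∞ (T% W) p)
    (u : TangentSpace I p) : S.hermitianConnection (fun q => S.J q (W q)) p u =
      S.J p (S.hermitianConnection W p u) := by
  have h := S.covJ_apply hW u
  rw [hermitianConnection_apply, hermitianConnection_apply, S.covJ_J, eq_sub_iff_add_eq.1 h |>.symm]
  simp only [map_add, map_neg, map_smul, S.J_sq]
  module

/-- If `D J = 0` then `D Ψ` is complex linear. -/
lemma covPsiForm_complexLinear {D : Connection I M}
    (hD : ∀ {p : M} {W : Π q : M, TangentSpace I q}, CMDiffAt ∞ (T% W) p → ∀ u,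
      D (fun q => S.J q (W q)) p u = S.J p (D W p u)) (p : M) (u : TangentSpace I p) :
    IsComplexLinearForm (S.J p) (S.covPsiForm D p u) := by
  intro v i
  set V : Fin n → Π q : M, TangentSpace I q := fun i => FiberBundle.extend E (v i) with hVdef
  have hV : ∀ j, MDiffAt (T% (V j)) p := fun j => mdiffAt_extend _
  have hJ : MDiffAt (T% fun q => S.J q (V i q)) p := S.mdiffAt_J (cmdiffAt_extend _)
  have h1 := S.covPsiForm_apply D (mdiffAt_update hV i hJ) u
  have h2 : (fun j => Function.update V i (fun q => S.J q (V i q)) j p) =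
      Function.update v i (S.J p (v i)) := by
    rw [update_field_apply]
    simp [hVdef]
  rw [h2] at h1
  have h4 : S.covPsiForm D p u v = S.covPsi D (Function.update V i (V i)) p u := by
    rw [Function.update_eq_self]; rfl
  rw [h1, h4]
  simp only [covPsi, sum_psi_update_update]
  have h5 : (fun q => S.Psi q fun j => Function.update V i (fun q => S.J q (V i q)) j q) =
      fun q => ContinuousLinearMap.mul ℝ ℂ Complex.I
        (S.Psi q fun j => Function.update V i (V i) j q) := by
    ext1 q
    rw [update_field_apply, Function.update_eq_self, ContinuousLinearMap.mul_apply']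
    exact S.Psi_complexLinear q _ i
  have h6 : ∀ (w : Fin n → TangentSpace I p) (x : TangentSpace I p),
      S.Psi p (Function.update w i (S.J p x)) = Complex.I * S.Psi p (Function.update w i x) := by
    intro w x
    have := S.Psi_complexLinear p (Function.update w i x) i
    simpa using this
  rw [h5, mvfderiv_clm _ (S.mdiffAt_psi (mdiffAt_update hV i (hV i))),
    hD (W := V i) (cmdiffAt_extend (v i))]
  simp only [h6, ContinuousLinearMap.mul_apply', Finset.mul_sum, mul_sub, mul_add]

/-- The derivative of `|Ψ(e_1, …, e_n)|²` at a unitary frame. -/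
lemma two_mul_re_conj_mul_mvfderiv_psi {p : M} {e : Fin n → TangentSpace I p}
    (he : IsUnitaryFrame (S.metric.inner p) (S.J p) e) (u : TangentSpace I p) :
    2 * (mvfderiv I (fun q => S.Psi q fun i => (FiberBundle.extend E (e i) :
      Π q : M, TangentSpace I q) q) p u * (starRingEnd ℂ) (S.Psi p e)).re =
    ∑ i, d% (fun q => S.metric.inner q (FiberBundle.extend E (e i) q)
      (FiberBundle.extend E (e i) q)) p u := by
  set U : Fin n → Π q : M, TangentSpace I q := fun i => FiberBundle.extend E (e i) with hU
  have hUp : ∀ i, U i p = e i := fun i => FiberBundle.extend_apply_self ..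
  have hmU : ∀ i, MDiffAt (T% (U i)) p := fun i => mdiffAt_extend _
  have hψ := S.mdiffAt_psi hmU
  obtain ⟨L, hL, hdet⟩ := exists_hasFDerivAt_det_one n
  let A : Fin n → Fin n → M → ℂ := fun i j q =>
    (S.metric.inner q (U i q) (U j q) : ℂ) + Complex.I * S.metric.inner q (U i q) (S.J q (U j q))
  have hg : ∀ i j, MDiffAt (fun q => S.metric.inner q (U i q) (U j q)) p := fun i j =>
    mdiffAt_inner _ (hmU i) (hmU j)
  have hω : ∀ i j, MDiffAt (fun q => S.metric.inner q (U i q) (S.J q (U j q))) p := fun i j =>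
    mdiffAt_inner _ (hmU i) (S.mdiffAt_J (cmdiffAt_extend _))
  have hA : ∀ i j, MDifferentiableAt I 𝓘(ℝ, ℂ) (A i j) p := fun i j =>
    (mdifferentiableAt_comp Complex.ofRealCLM.differentiableAt (hg i j)).add
      (mdifferentiableAt_comp (φ := fun x : ℝ => Complex.I * (x : ℂ))
        (Complex.ofRealCLM.differentiableAt.const_mul _) (hω i j))
  have hAm : MDifferentiableAt I 𝓘(ℝ, Fin n → Fin n → ℂ) (fun q i j => A i j q) p :=
    mdifferentiableAt_pi_of_forall fun i => mdifferentiableAt_pi_of_forall fun j => hA i j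
  have hA1 : (fun i j => A i j p) = fun i j => (1 : Matrix (Fin n) (Fin n) ℂ) i j := by
    ext i j
    simp only [A, hUp, he.inner_eq, he.inner_J_eq, Matrix.one_apply]
    split_ifs <;> simp
  have hfun : ∀ q, ‖S.Psi q fun i => U i q‖ ^ 2 =
      Complex.reCLM ((Matrix.of fun i j => A i j q).det) := by
    intro q
    obtain ⟨v, hv⟩ := S.exists_unitaryFrame q
    have h1 := (S.psiForm_complexLinear q).mul_conj (S.hermitian q) hv
      (S.finrank_tangentSpace q) fun i => U i q
    simp only [psiForm_apply, S.psi_mul_conj hv, one_mul] at h1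
    rw [← h1, Complex.mul_conj, Complex.normSq_eq_norm_sq, Complex.reCLM_apply, Complex.ofReal_re]
  have h1 : d% (fun q => ‖S.Psi q fun i => U i q‖ ^ 2) p u =
      2 * (mvfderiv I (fun q => S.Psi q fun i => U i q) p u *
        (starRingEnd ℂ) (S.Psi p e)).re := by
    have := mvfderiv_comp_apply' (f := fun q => S.Psi q fun i => U i q)
      ((hasFDerivAt_id (S.Psi p fun i => U i p)).norm_sq) hψ u
    have hUpe : (fun i => U i p) = e := funext hUp
    simp only [id, hUpe] at this
    rw [this]
    simp [Complex.inner]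
    ring
  have h2 : d% (fun q => Complex.reCLM ((Matrix.of fun i j => A i j q).det)) p u =
      ∑ i, d% (fun q => S.metric.inner q (U i q) (U i q)) p u := by
    have h3 := mvfderiv_comp_apply' (f := fun q i j => A i j q)
      (Complex.reCLM.hasFDerivAt.comp _ (hA1 ▸ hdet)) hAm u
    refine h3.trans ?_
    rw [ContinuousLinearMap.comp_apply, hL, map_sum]
    refine Finset.sum_congr rfl fun i _ => ?_
    have h4 := mvfderiv_clm (Complex.reCLM.comp
      ((ContinuousLinearMap.proj (R := ℝ) (φ := fun _ : Fin n => ℂ) i).comp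
        (ContinuousLinearMap.proj (R := ℝ) (φ := fun _ : Fin n => Fin n → ℂ) i)))
      hAm u
    refine h4.symm.trans ?_
    congr 2
    ext1 q
    simp [A]
  rw [← h1, ← h2]
  congr 2
  exact funext hfun

/-- If `D` is metric, then `D Ψ` is an imaginary multiple of `Ψ` in unitary frames. -/
lemma re_covPsiForm_mul_conj {D : Connection I M} (hD : IsMetricConnection S.metric D) {p : M}
    {e : Fin n → TangentSpace I p} (he : IsUnitaryFrame (S.metric.inner p) (S.J p) e)
    (u : TangentSpace I p) :
    (S.covPsiForm D p u e * (starRingEnd ℂ) (S.Psi p e)).re = 0 := by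
  have h1 := S.two_mul_re_conj_mul_mvfderiv_psi he u
  have h2 : ∀ i, S.Psi p (Function.update e i (D (FiberBundle.extend E (e i)) p u)) =
      frameCoord (S.metric.inner p) (S.J p) e (D (FiberBundle.extend E (e i)) p u) i *
        S.Psi p e := fun i =>
    (S.psiForm_complexLinear p).map_update (S.hermitian p) he (S.finrank_tangentSpace p) i _
  have h3 : ∀ i, d% (fun q => S.metric.inner q (FiberBundle.extend E (e i) q)
      (FiberBundle.extend E (e i) q)) p u =
      2 * (frameCoord (S.metric.inner p) (S.J p) e (D (FiberBundle.extend E (e i)) p u) i).re := by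
    intro i
    rw [hD p u _ _ (mdiffAt_extend _) (mdiffAt_extend _)]
    simp only [FiberBundle.extend_apply_self, frameCoord]
    rw [(S.hermitian p).symm (e i)]
    simp
    ring
  simp only [h3, ← Finset.mul_sum] at h1
  have h4 := S.psi_mul_conj he
  rw [covPsiForm_extend, covPsi]
  simp only [FiberBundle.extend_apply_self, h2]
  rw [← Finset.sum_mul, sub_mul, mul_assoc, h4, mul_one, Complex.sub_re, Complex.re_sum]
  linarith

lemma covPsiForm_add (D : Connection I M) (p : M) (u u' : TangentSpace I p)
    (v : Fin n → TangentSpace I p) :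
    S.covPsiForm D p (u + u') v = S.covPsiForm D p u v + S.covPsiForm D p u' v := by
  simp [covPsiForm_extend, covPsi, Finset.sum_add_distrib]
  ring

lemma covPsiForm_smul (D : Connection I M) (p : M) (c : ℝ) (u : TangentSpace I p)
    (v : Fin n → TangentSpace I p) :
    S.covPsiForm D p (c • u) v = c * S.covPsiForm D p u v := by
  simp [covPsiForm_extend, covPsi, Finset.mul_sum, mul_sub]

/-- The one-form `c` with `D_u Ψ = i n c(u) Ψ` for the Hermitian connection `D`. -/
noncomputable def lineForm (p : M) : TangentSpace I p →L[ℝ] ℝ :=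
  LinearMap.toContinuousLinearMap
    { toFun := fun u =>
        (1 / (n : ℝ)) * (S.covPsiForm S.hermitianConnection p u (S.exists_unitaryFrame p).choose *
          (starRingEnd ℂ) (S.Psi p (S.exists_unitaryFrame p).choose)).im
      map_add' := fun u u' => by
        rw [covPsiForm_add, add_mul, Complex.add_im, mul_add]
      map_smul' := fun c u => by
        rw [covPsiForm_smul, mul_assoc, Complex.im_ofReal_mul]
        simp
        ring }

lemma covPsiForm_hermitianConnection (hn : n ≠ 0) (p : M) (u : TangentSpace I p)
    (v : Fin n → TangentSpace I p) :
    S.covPsiForm S.hermitianConnection p u v =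
      n * (S.lineForm p u : ℂ) * Complex.I * S.Psi p v := by
  set e := (S.exists_unitaryFrame p).choose with he_def
  have he : IsUnitaryFrame (S.metric.inner p) (S.J p) e := (S.exists_unitaryFrame p).choose_spec
  have h1 := (S.psiForm_complexLinear p).mul_comm_of
    (S.covPsiForm_complexLinear S.hermitianConnection_J p u) (S.hermitian p) he
    (S.finrank_tangentSpace p) v
  rw [psiForm_apply, psiForm_apply] at h1
  have h2 := S.re_covPsiForm_mul_conj S.isMetricConnection_hermitianConnection he u
  have h3 : S.covPsiForm S.hermitianConnection p u e * (starRingEnd ℂ) (S.Psi p e) =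
      n * (S.lineForm p u : ℂ) * Complex.I := by
    have h4 : S.lineForm p u = (1 / (n : ℝ)) *
      (S.covPsiForm S.hermitianConnection p u e * (starRingEnd ℂ) (S.Psi p e)).im := rfl
    have hn' : (n : ℝ) ≠ 0 := by exact_mod_cast hn
    have h5 : (n : ℝ) * S.lineForm p u =
        (S.covPsiForm S.hermitianConnection p u e * (starRingEnd ℂ) (S.Psi p e)).im := by
      rw [h4]; field_simp
    have h6 : (n : ℂ) * (S.lineForm p u : ℂ) = ((n : ℝ) * S.lineForm p u : ℝ) := by push_cast; rfl
    rw [h6, h5]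
    apply Complex.ext
    · rw [h2]; simp
    · simp
  have h7 := S.psi_mul_conj he
  linear_combination (starRingEnd ℂ) (S.Psi p e) * h1 + S.Psi p v * h3 -
    S.covPsiForm S.hermitianConnection p u v * h7

/-- The endomorphism-valued one-form `w ↦ u ↦ c(u) J w`. -/
noncomputable def lineFormJ (p : M) :
    TangentSpace I p →L[ℝ] TangentSpace I p →L[ℝ] TangentSpace I p :=
  LinearMap.toContinuousLinearMap
    { toFun := fun w => (S.lineForm p).smulRight (S.J p w)
      map_add' := fun w w' => by ext u; simp
      map_smul' := fun c w => by ext u; simp [smul_comm c] }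

/-- The connection `∇ - ½ J (∇ J) + c J`. -/
noncomputable def specialConnection : Connection I M :=
  S.hermitianConnection.addOneForm S.lineFormJ

lemma specialConnection_apply (W : Π q : M, TangentSpace I q) (p : M) (u : TangentSpace I p) :
    S.specialConnection W p u =
      S.hermitianConnection W p u + S.lineForm p u • S.J p (W p) := rfl

lemma specialConnection_difference (p : M) (w u : TangentSpace I p) :
    S.specialConnection.difference (leviCivita S.metric) p w u =
      (-(1 / 2) : ℝ) • S.J p (S.covJ p w u) + S.lineForm p u • S.J p w := by
  have := difference_apply S.specialConnection (leviCivita S.metric) (mdiffAt_extend w) u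
  rw [specialConnection_apply, hermitianConnection_apply] at this
  simp only [FiberBundle.extend_apply_self] at this
  rw [this]
  abel

lemma isMetricConnection_specialConnection :
    IsMetricConnection S.metric S.specialConnection := by
  refine S.isMetricConnection_hermitianConnection.addOneForm fun p u v w => ?_
  change S.metric.inner p (S.lineForm p u • S.J p v) w +
    S.metric.inner p v (S.lineForm p u • S.J p w) = 0
  simp only [map_smul, FunLike.coe_smul, Pi.smul_apply, smul_eq_mul,
    (S.hermitian p).inner_J_left]
  ring

lemma specialConnection_J {p : M} {W : Π q : M, TangentSpace I q} (hW : CMDiffAt ∞ (T% W) p)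
    (u : TangentSpace I p) : S.specialConnection (fun q => S.J q (W q)) p u =
      S.J p (S.specialConnection W p u) := by
  rw [specialConnection_apply, specialConnection_apply, S.hermitianConnection_J hW, map_add,
    map_smul]

lemma covDeriv_omega_eq_zero {D : Connection I M} (hD : IsMetricConnection S.metric D)
    (hJ : ∀ {p : M} {W : Π q : M, TangentSpace I q}, CMDiffAt ∞ (T% W) p → ∀ u,
      D (fun q => S.J q (W q)) p u = S.J p (D W p u)) (p : M) (u : TangentSpace I p)
    (v : Fin 2 → TangentSpace I p) : covDeriv D S.omega p u v = 0 := by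
  have h := hD p u _ _ (mdiffAt_extend (v 0)) (S.mdiffAt_J (cmdiffAt_extend (v 1)))
  rw [hJ (cmdiffAt_extend (v 1))] at h
  simp only [FiberBundle.extend_apply_self] at h
  simp [covDeriv, omega, h]

lemma covPsiForm_specialConnection (hn : n ≠ 0) (p : M) (u : TangentSpace I p)
    (v : Fin n → TangentSpace I p) : S.covPsiForm S.specialConnection p u v = 0 := by
  have h : ∀ i, S.Psi p (Function.update v i
      (S.specialConnection.difference S.hermitianConnection p (v i) u)) =
      S.lineForm p u * (Complex.I * S.Psi p v) := fun i => by
    rw [specialConnection, difference_addOneForm, ← S.Psi_complexLinear p v i]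
    change S.Psi p (Function.update v i (S.lineForm p u • S.J p (v i))) = _
    simp
  rw [S.covPsiForm_difference S.hermitianConnection, S.covPsiForm_hermitianConnection hn]
  simp only [h]
  simp
  ring

end SpecialAlmostHermitian

lemma trace_mul_eq_zero_of_anticommute {V : Type*} [AddCommGroup V] [Module ℝ V]
    {J X A : Module.End ℝ V} (hJ : J * J = -1) (hX : X * J = -(J * X)) (hA : A * J = J * A) :
    LinearMap.trace ℝ V (X * A) = 0 := by
  have h1 : X * A = -(X * A * J * J) := by
    rw [mul_assoc, hJ]
    simp
  have h2 : J * (X * A * J) = X * A := by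
    rw [mul_assoc X, hA, ← mul_assoc, ← mul_assoc, ← neg_eq_iff_eq_neg.2 hX]
    rw [neg_mul, neg_mul, mul_assoc X, hJ]
    simp
  have h3 := congrArg (LinearMap.trace ℝ V) h1
  rw [map_neg, LinearMap.trace_mul_comm ℝ (X * A * J) J, h2] at h3
  linarith

namespace SpecialAlmostHermitian

variable {n : ℕ} (S : SpecialAlmostHermitian n I M)

lemma IsSU.comm {S : SpecialAlmostHermitian n I M} {p : M} {A : Module.End ℝ (TangentSpace I p)}
    (hA : S.IsSU p A) : A * (S.J p : TangentSpace I p →ₗ[ℝ] TangentSpace I p) =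
      (S.J p : TangentSpace I p →ₗ[ℝ] TangentSpace I p) * A := by
  ext w
  refine inner_ext S.metric p fun v => ?_
  have h1 := hA.omega ![v, w]
  have h2 := hA.metric v (S.J p w)
  simp [SpecialAlmostHermitian.omega] at h1
  rw [(S.hermitian p).symm, (S.hermitian p).symm _ v]
  simp
  linarith

lemma IsSU.soInner_J {S : SpecialAlmostHermitian n I M} {p : M}
    {A : Module.End ℝ (TangentSpace I p)} (hA : S.IsSU p A) :
    soInner A (S.J p : TangentSpace I p →ₗ[ℝ] TangentSpace I p) = 0 := by
  obtain ⟨e, he⟩ := S.exists_unitaryFrame p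
  have h1 := (S.psiForm_complexLinear p).sum_update_skew (S.hermitian p) he
    (S.finrank_tangentSpace p) (A := A) hA.metric
  have h2 : ∑ i, S.psiForm p (Function.update e i (A (e i))) = 0 := by
    apply Complex.ext
    · rw [Complex.re_sum]; exact hA.psiPlus e
    · rw [Complex.im_sum]; exact hA.psiMinus e
  rw [h2, eq_comm, mul_eq_zero, mul_eq_zero] at h1
  have h3 : ∑ i, S.metric.inner p (A (e i)) (S.J p (e i)) = 0 := by
    rcases h1 with (h1 | h1) | h1
    · exact absurd h1 Complex.I_ne_zero
    · exact_mod_cast h1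
    · exact absurd h1 (S.psi_ne_zero he)
  rw [soInner, he.neg_trace_mul_J (S.hermitian p) (S.finrank_tangentSpace p) hA.metric, h3,
    mul_zero]

/-- `∇ - ½ J (∇ J) + c J` is the minimal `SU(n)`-connection. -/
theorem isMinimal_specialConnection (hn : n ≠ 0) : S.IsMinimal S.specialConnection where
  metric := S.isMetricConnection_specialConnection.covDeriv_metric
  omega := S.covDeriv_omega_eq_zero S.isMetricConnection_specialConnection S.specialConnection_J
  psiPlus p u v := by rw [covDeriv_psiPlus, S.covPsiForm_specialConnection hn, Complex.zero_re]
  psiMinus p u v := by rw [covDeriv_psiMinus, S.covPsiForm_specialConnection hn, Complex.zero_im]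
  orthogonal p u A hA := by
    set J : Module.End ℝ (TangentSpace I p) := (S.J p : TangentSpace I p →ₗ[ℝ] TangentSpace I p)
    let X : Module.End ℝ (TangentSpace I p) :=
      J * { toFun := fun w => S.covJ p w u, map_add' := by simp, map_smul' := by simp }
    have hT : S.torsionOf S.specialConnection p u = (-(1 / 2) : ℝ) • X + S.lineForm p u • J := by
      ext w
      exact S.specialConnection_difference p w u
    have hJ2 : J * J = -1 := by
      ext w
      exact S.J_sq p w
    have hXJ : X * J = -(J * X) := by
      ext w
      change S.J p (S.covJ p (S.J p w) u) = -S.J p (S.J p (S.covJ p w u))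
      rw [S.covJ_J, map_neg]
    have h1 := trace_mul_eq_zero_of_anticommute hJ2 hXJ hA.comm
    have h2 := hA.soInner_J
    rw [soInner, LinearMap.trace_mul_comm] at h2
    change -LinearMap.trace ℝ _ (J * A) = 0 at h2
    rw [soInner, hT, add_mul, smul_mul_assoc, smul_mul_assoc, map_add, map_smul, map_smul, h1,
      neg_eq_zero.1 h2]
    simp

lemma isMinimal_minimalConnection (hn : n ≠ 0) : S.IsMinimal S.minimalConnection := by
  have h : ∃ D, S.IsMinimal D := ⟨_, S.isMinimal_specialConnection hn⟩
  rw [minimalConnection, dif_pos h]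
  exact h.choose_spec

lemma IsMinimal.torsionOf_skew {S : SpecialAlmostHermitian n I M} {D : Connection I M}
    (hD : S.IsMinimal D) (p : M) (u v w : TangentSpace I p) :
    S.metric.inner p (S.torsionOf D p u v) w + S.metric.inner p v (S.torsionOf D p u w) = 0 := by
  have h1 := hD.metric p u ![v, w]
  have h2 := isMetricConnection_leviCivita S.metric p u _ _ (mdiffAt_extend v) (mdiffAt_extend w)
  have h3 : ∀ v, S.torsionOf D p u v = D (FiberBundle.extend E v) p u -
      leviCivita S.metric (FiberBundle.extend E v) p u := fun v => by
    have := difference_apply D (leviCivita S.metric) (mdiffAt_extend v) u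
    rwa [FiberBundle.extend_apply_self] at this
  simp only [FiberBundle.extend_apply_self] at h2
  simp [covDeriv, h2] at h1
  rw [h3, h3]
  simp only [map_sub, FunLike.coe_sub, Pi.sub_apply]
  linarith

/-- In unitary frames, `∇_u Ψ = i n c(u) Ψ` where `c` is the line component of the intrinsic
torsion. -/
theorem covPsiForm_leviCivita (hn : n ≠ 0) {p : M} {e : Fin n → TangentSpace I p}
    (he : IsUnitaryFrame (S.metric.inner p) (S.J p) e) (u : TangentSpace I p) :
    S.covPsiForm (leviCivita S.metric) p u e =
      Complex.I * ((n * S.lineComponent p u : ℝ) : ℂ) * S.Psi p e := by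
  have hD := S.isMinimal_minimalConnection hn
  set D := S.minimalConnection with hDdef
  have h0 : S.covPsiForm D p u e = 0 := by
    apply Complex.ext
    · rw [← covDeriv_psiPlus]; exact hD.psiPlus p u e
    · rw [← covDeriv_psiMinus]; exact hD.psiMinus p u e
  have h1 := S.covPsiForm_difference (leviCivita S.metric) D p u e
  have h2 := (S.psiForm_complexLinear p).sum_update_skew (S.hermitian p) he
    (S.finrank_tangentSpace p) (A := S.torsionOf D p u) (hD.torsionOf_skew p u)
  have h3 := he.neg_trace_mul_J (S.hermitian p) (S.finrank_tangentSpace p)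
    (hD.torsionOf_skew p u)
  have h4 := he.neg_trace_mul_J (S.hermitian p) (S.finrank_tangentSpace p)
    (A := (S.J p : TangentSpace I p →ₗ[ℝ] TangentSpace I p)) (fun v w => by
      have := (S.hermitian p).inner_J_left v w
      simp only [ContinuousLinearMap.coe_coe]
      linarith)
  have h5 : n * S.lineComponent p u =
      ∑ i, S.metric.inner p (S.torsionOf D p u (e i)) (S.J p (e i)) := by
    rw [lineComponent, intrinsicTorsion, ← hDdef, soInner, soInner]
    have hn' : (n : ℝ) ≠ 0 := by exact_mod_cast hn
    refine (congrArg₂ (fun a b : ℝ => n * (a / b)) h3 h4).trans ?_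
    simp [(S.hermitian p).orth, he.inner_eq]
    field_simp
  rw [h0, eq_comm, sub_eq_zero] at h1
  rw [h1, h5]
  exact h2

end SpecialAlmostHermitian

lemma difference_apply_extend (D' D : Connection I M) (p : M) (w u : TangentSpace I p) :
    D'.difference D p w u =
      D' (FiberBundle.extend E w) p u - D (FiberBundle.extend E w) p u := by
  have := difference_apply D' D (mdiffAt_extend w) u
  rwa [FiberBundle.extend_apply_self] at this

section ConformalChange

variable (g : Metric I M) {f : M → ℝ} (hf : ContMDiff I 𝓘(ℝ, ℝ) ∞ f)

lemma conformalMetric_inner (p : M) (v w : TangentSpace I p) :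
    (conformalMetric g f hf).inner p v w = Real.exp (2 * f p) * g.inner p v w := rfl

lemma mvfderiv_exp_mul (c : ℝ) {p : M} (hf : MDiffAt f p) (u : TangentSpace I p) :
    d% (fun q => Real.exp (c * f q)) p u = c * Real.exp (c * f p) * d% f p u := by
  have := mvfderiv_comp_apply' (φ := fun x => Real.exp (c * x))
    (((hasDerivAt_id (f p)).const_mul c).exp.hasFDerivAt) hf u
  refine this.trans ?_
  simp
  ring

lemma mdiffAt_exp_mul (c : ℝ) {p : M} (hf : MDiffAt f p) :
    MDiffAt (fun q => Real.exp (c * f q)) p :=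
  mdifferentiableAt_comp (φ := fun x => Real.exp (c * x)) (by fun_prop) hf

lemma leviCivita_difference_symm (g g' : Metric I M) (p : M) (w u : TangentSpace I p) :
    (leviCivita g').difference (leviCivita g) p w u =
      (leviCivita g').difference (leviCivita g) p u w := by
  have h1 := (CovariantDerivative.torsion_eq_zero_iff _).1 (leviCivita_spec g).torsion_free
    (mdiffAt_extend w) (mdiffAt_extend u)
  have h2 := (CovariantDerivative.torsion_eq_zero_iff _).1 (leviCivita_spec g').torsion_free
    (mdiffAt_extend w) (mdiffAt_extend u)
  simp only [FiberBundle.extend_apply_self] at h1 h2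
  rw [difference_apply_extend, difference_apply_extend]
  have h3 := h2.trans h1.symm
  rw [sub_eq_sub_iff_add_eq_add] at h3 ⊢
  rw [← h3.symm, add_comm]

/-- The conformal change of the Levi-Civita connection. -/
lemma leviCivita_conformalMetric_difference (p : M) (w u : TangentSpace I p) :
    (leviCivita (conformalMetric g f hf)).difference (leviCivita g) p w u =
      d% f p u • w + d% f p w • u - g.inner p u w • sharp g p (d% f p) := by
  have hfp : MDiffAt f p := (hf p).mdifferentiableAt (by simp)
  set A := (leviCivita (conformalMetric g f hf)).difference (leviCivita g) p with hA
  have hsymm : ∀ w u, A w u = A u w := leviCivita_difference_symm g (conformalMetric g f hf) p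
  have hmetric : ∀ u v w, g.inner p (A v u) w + g.inner p v (A w u) =
      2 * d% f p u * g.inner p v w := by
    intro u v w
    have h1 := (leviCivita_spec g).metric p u _ _ (mdiffAt_extend v) (mdiffAt_extend w)
    have h2 := (leviCivita_spec (conformalMetric g f hf)).metric p u _ _
      (mdiffAt_extend v) (mdiffAt_extend w)
    have h4 := mvfderiv_mul (mdiffAt_exp_mul 2 hfp)
      (mdiffAt_inner g (mdiffAt_extend v) (mdiffAt_extend w))
    simp only [Pi.mul_def] at h4
    simp only [conformalMetric_inner, h4, FunLike.coe_add, Pi.add_apply, FunLike.coe_smul,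
      Pi.smul_apply, smul_eq_mul, mvfderiv_exp_mul 2 hfp, h1, FiberBundle.extend_apply_self] at h2
    have h5 : Real.exp (2 * f p) ≠ 0 := (Real.exp_pos _).ne'
    apply mul_left_cancel₀ h5
    rw [hA, difference_apply_extend, difference_apply_extend]
    simp only [map_sub, FunLike.coe_sub, Pi.sub_apply]
    linear_combination -h2
  let B : TangentSpace I p → TangentSpace I p → TangentSpace I p := fun w u =>
    A w u - (d% f p u • w + d% f p w • u - g.inner p u w • sharp g p (d% f p))
  have hB1 : ∀ w u, B w u = B u w := fun w u => by
    simp only [B, hsymm w u, g.symm p w u]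
    abel
  have hB2 : ∀ u v w, g.inner p (B v u) w + g.inner p v (B w u) = 0 := fun u v w => by
    have h1 := hmetric u v w
    have h2 := inner_sharp g p (d% f p)
    have h3 := g.symm p v (sharp g p (d% f p))
    simp only [B, map_sub, map_add, map_smul, FunLike.coe_sub, FunLike.coe_add, FunLike.coe_smul,
      Pi.sub_apply, Pi.add_apply, Pi.smul_apply, smul_eq_mul, h3, h2]
    rw [g.symm p v u]
    linear_combination h1
  have hB : B w u = 0 := by
    refine inner_ext g p fun v => ?_
    rw [map_zero, FunLike.coe_zero, Pi.zero_apply]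
    have e1 := hB2 u w v
    have e2 := hB2 w u v
    have e3 := hB2 v w u
    rw [g.symm p w] at e1 e3
    rw [g.symm p u] at e2
    rw [hB1 u w] at e2
    rw [hB1 v u] at e1
    rw [hB1 v w] at e2
    linarith
  exact sub_eq_zero.1 hB

end ConformalChange

section Trace

variable (g : Metric I M) (p : M)

/-- The Gram matrix of the metric in the basis used in `metricTrace`. -/
noncomputable def gramMatrix :
    Matrix (Fin (Module.finrank ℝ E)) (Fin (Module.finrank ℝ E)) ℝ :=
  Matrix.of fun i j => g.inner p (Module.finBasis ℝ E i : E) (Module.finBasis ℝ E j : E)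

/-- The basis used in `metricTrace`. -/
noncomputable def tangentBasis :
    Module.Basis (Fin (Module.finrank ℝ E)) ℝ (TangentSpace I p) :=
  Module.finBasis ℝ E

lemma gramMatrix_apply (i j) :
    gramMatrix g p i j = g.inner p (tangentBasis p i) (tangentBasis p j) := rfl

lemma metricTrace_eq (B : TangentSpace I p → TangentSpace I p → ℝ) : metricTrace g p B =
    ∑ i, ∑ j, (gramMatrix g p)⁻¹ i j * B (tangentBasis p i) (tangentBasis p j) := rfl

lemma gramMatrix_isUnit_det : IsUnit (gramMatrix g p).det := by
  rw [isUnit_iff_ne_zero]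
  intro h
  obtain ⟨x, hx, h0⟩ := Matrix.exists_mulVec_eq_zero_iff.2 h
  have h1 : g.inner p (∑ i, x i • tangentBasis p i) (∑ i, x i • tangentBasis p i) = 0 := by
    rw [map_sum]
    refine Finset.sum_eq_zero fun i _ => ?_
    have := congrFun h0 i
    simp only [Matrix.mulVec, dotProduct, gramMatrix_apply, Pi.zero_apply] at this
    rw [map_smul, g.symm, map_sum]
    simp only [map_smul, smul_eq_mul]
    rw [mul_eq_zero]
    right
    rw [← this]
    exact Finset.sum_congr rfl fun j _ => mul_comm _ _
  have h2 : ∑ i, x i • tangentBasis (I := I) p i = 0 := by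
    by_contra hne
    exact (g.pos p _ hne).ne' h1
  exact hx (funext fun i => Fintype.linearIndependent_iff.1
    (tangentBasis (I := I) p).linearIndependent x h2 i)

lemma gramMatrix_transpose : (gramMatrix g p).transpose = gramMatrix g p := by
  ext i j
  exact g.symm p _ _

lemma metricTrace_inner_mul_inner (x y : TangentSpace I p) :
    metricTrace g p (fun a b => g.inner p x a * g.inner p y b) = g.inner p x y := by
  have hy := (tangentBasis (I := I) p).sum_repr y
  set c := (tangentBasis (I := I) p).repr y with hc
  have h1 : ∀ j, g.inner p y (tangentBasis p j) = ∑ k, c k * gramMatrix g p k j := fun j => by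
    conv_lhs => rw [← hy]
    simp [gramMatrix_apply]
  have h2 : ∀ i, ∑ j, (gramMatrix g p)⁻¹ i j * g.inner p y (tangentBasis p j) = c i := fun i => by
    have h3 : (gramMatrix g p)⁻¹ * gramMatrix g p = 1 :=
      Matrix.nonsing_inv_mul _ (gramMatrix_isUnit_det g p)
    have h4 : ∀ k, ∑ j, (gramMatrix g p)⁻¹ i j * gramMatrix g p k j = if i = k then 1 else 0 :=
      fun k => by
        rw [← Matrix.one_apply, ← h3, Matrix.mul_apply]
        refine Finset.sum_congr rfl fun j _ => ?_
        rw [← Matrix.transpose_apply (gramMatrix g p) j k, gramMatrix_transpose]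
    simp only [h1, Finset.mul_sum]
    rw [Finset.sum_comm]
    simp only [mul_left_comm _ (c _), ← Finset.mul_sum, h4]
    simp
  rw [metricTrace_eq]
  conv_rhs => rw [← hy]
  rw [map_sum]
  refine Finset.sum_congr rfl fun i _ => ?_
  simp only [mul_left_comm _ (g.inner p x (tangentBasis p i)), ← Finset.mul_sum, h2]
  simp [mul_comm]

lemma metricTrace_inner :
    metricTrace g p (fun a b => g.inner p a b) = Module.finrank ℝ E := by
  have h3 : (gramMatrix g p)⁻¹ * gramMatrix g p = 1 :=
    Matrix.nonsing_inv_mul _ (gramMatrix_isUnit_det g p)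
  have h4 := congrArg Matrix.trace h3
  rw [Matrix.trace_one, Fintype.card_fin] at h4
  rw [metricTrace_eq, ← h4, Matrix.trace]
  refine Finset.sum_congr rfl fun i _ => ?_
  rw [Matrix.diag_apply, Matrix.mul_apply]
  refine Finset.sum_congr rfl fun j _ => ?_
  rw [← gramMatrix_apply, ← Matrix.transpose_apply (gramMatrix g p) j i, gramMatrix_transpose]

lemma metricTrace_eq_zero_of_skew {B : TangentSpace I p → TangentSpace I p → ℝ}
    (hB : ∀ a b, B a b = -B b a) : metricTrace g p B = 0 := by
  have h1 : ∀ i j, (gramMatrix g p)⁻¹ i j = (gramMatrix g p)⁻¹ j i := fun i j => by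
    conv_lhs => rw [← gramMatrix_transpose, ← Matrix.transpose_nonsing_inv,
      Matrix.transpose_apply]
  have h2 : metricTrace g p B = -metricTrace g p B := by
    conv_rhs => rw [metricTrace_eq, Finset.sum_comm]
    rw [metricTrace_eq, ← Finset.sum_neg_distrib]
    refine Finset.sum_congr rfl fun i _ => ?_
    rw [← Finset.sum_neg_distrib]
    refine Finset.sum_congr rfl fun j _ => ?_
    rw [hB, h1]
    ring
  linarith

lemma metricTrace_add (B B' : TangentSpace I p → TangentSpace I p → ℝ) :
    metricTrace g p (fun a b => B a b + B' a b) = metricTrace g p B + metricTrace g p B' := by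
  simp [metricTrace_eq, mul_add, Finset.sum_add_distrib]

lemma metricTrace_mul (c : ℝ) (B : TangentSpace I p → TangentSpace I p → ℝ) :
    metricTrace g p (fun a b => c * B a b) = c * metricTrace g p B := by
  simp only [metricTrace_eq, Finset.mul_sum]
  exact Finset.sum_congr rfl fun i _ => Finset.sum_congr rfl fun j _ => by ring

lemma metricTrace_conformalMetric {f : M → ℝ} (hf : ContMDiff I 𝓘(ℝ, ℝ) ∞ f)
    (B : TangentSpace I p → TangentSpace I p → ℝ) :
    metricTrace (conformalMetric g f hf) p B = (Real.exp (2 * f p))⁻¹ * metricTrace g p B := by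
  have h1 : gramMatrix (conformalMetric g f hf) p =
      Units.mk0 (Real.exp (2 * f p)) (Real.exp_pos _).ne' • gramMatrix g p := by
    ext i j
    rfl
  simp only [metricTrace_eq, h1, Matrix.inv_smul' _ _ (gramMatrix_isUnit_det g p), Finset.mul_sum]
  refine Finset.sum_congr rfl fun i _ => Finset.sum_congr rfl fun j _ => ?_
  rw [← mul_assoc]
  rfl

end Trace

namespace SpecialAlmostHermitian

variable {n : ℕ} (S : SpecialAlmostHermitian n I M) {f : M → ℝ} (hf : ContMDiff I 𝓘(ℝ, ℝ) ∞ f)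

lemma covDeriv_omega_conformalChange (p : M) (a b v : TangentSpace I p) :
    covDeriv (leviCivita (S.conformalChange f hf).metric) (S.conformalChange f hf).omega p a
        ![b, v] =
      Real.exp (2 * f p) * (covDeriv (leviCivita S.metric) S.omega p a ![b, v]
        - d% f p b * S.metric.inner p a (S.J p v)
        + S.metric.inner p a b * d% f p (S.J p v)
        + d% f p v * S.metric.inner p a (S.J p b)
        + S.metric.inner p a v * S.metric.inner p b (S.J p (sharp S.metric p (d% f p)))) := by
  have hfp : MDiffAt f p := (hf p).mdifferentiableAt (by simp)
  have hd := fun w => leviCivita_conformalMetric_difference S.metric hf p w a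
  simp only [difference_apply_extend, sub_eq_iff_eq_add] at hd
  have h1 := mvfderiv_mul (mdiffAt_exp_mul 2 hfp)
    (mdiffAt_inner S.metric (mdiffAt_extend b) (S.mdiffAt_J (cmdiffAt_extend v)))
  simp only [Pi.mul_def] at h1
  have h2 := inner_sharp S.metric p (d% f p)
  have h3 := (S.hermitian p).inner_J_left b a
  rw [S.metric.symm] at h3
  simp [covDeriv, omega, conformalChange, conformalMetric_inner, h1, mvfderiv_exp_mul 2 hfp, hd,
    h2, h3]
  ring

lemma codiff_omega_conformalChange (p : M) (v : TangentSpace I p) :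
    codiff₂ (S.conformalChange f hf).metric (S.conformalChange f hf).omega p v =
      codiff₂ S.metric S.omega p v - 2 * ((n : ℝ) - 1) * d% f p (S.J p v) := by
  set F := sharp S.metric p (d% f p) with hF
  have hdf : ∀ w, d% f p w = S.metric.inner p F w := fun w => (inner_sharp S.metric p _ w).symm
  have h := S.hermitian p
  have e : (fun a b => covDeriv (leviCivita (S.conformalChange f hf).metric)
      (S.conformalChange f hf).omega p a ![b, v]) = fun a b =>
      Real.exp (2 * f p) * (covDeriv (leviCivita S.metric) S.omega p a ![b, v]
        + ((-1) * (S.metric.inner p (S.J p v) a * S.metric.inner p F b)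
        + (d% f p (S.J p v) * S.metric.inner p a b
        + (d% f p v * S.metric.inner p a (S.J p b)
        + S.metric.inner p v a * S.metric.inner p (S.J p F) b)))) := by
    ext a b
    rw [covDeriv_omega_conformalChange, ← hF, hdf b, h.symm a (S.J p v), h.symm a v,
      h.symm b (S.J p F)]
    ring
  have h0 : metricTrace S.metric p (fun a b => S.metric.inner p a (S.J p b)) = 0 :=
    metricTrace_eq_zero_of_skew _ _ fun a b => by
      rw [← h.inner_J_left, h.symm]
  rw [codiff₂, codiff₂, e]
  change -metricTrace (conformalMetric S.metric f hf) p _ = _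
  rw [metricTrace_conformalMetric, metricTrace_mul, ← mul_assoc,
    inv_mul_cancel₀ (Real.exp_pos _).ne', metricTrace_add, metricTrace_add, metricTrace_add,
    metricTrace_add, metricTrace_mul, metricTrace_mul, metricTrace_mul,
    metricTrace_inner_mul_inner, metricTrace_inner_mul_inner, metricTrace_inner, h0, S.dim_eq,
    hdf (S.J p v), h.symm _ F, ← neg_eq_iff_eq_neg.2 (h.inner_J_left v F), h.symm _ F]
  push_cast
  ring

lemma actCodiffOmega_conformalChange (p : M) (u : TangentSpace I p) :
    (S.conformalChange f hf).actCodiffOmega p u =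
      S.actCodiffOmega p u - 2 * ((n : ℝ) - 1) * d% f p u := by
  change -codiff₂ (S.conformalChange f hf).metric (S.conformalChange f hf).omega p (S.J p u) =
    -codiff₂ S.metric S.omega p (S.J p u) - _
  rw [codiff_omega_conformalChange, S.J_sq, map_neg]
  ring

lemma covPsiForm_conformalChange (D : Connection I M) (p : M) (u : TangentSpace I p)
    (v : Fin n → TangentSpace I p) :
    (S.conformalChange f hf).covPsiForm D p u v = (Real.exp (n * f p) : ℂ) *
      (n * (d% f p u : ℂ) * S.Psi p v + S.covPsiForm D p u v) := by
  have hfp : MDiffAt f p := (hf p).mdifferentiableAt (by simp)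
  have h1 := mvfderiv_smul (mdiffAt_exp_mul n hfp)
    (S.mdiffAt_psi (V := fun i => FiberBundle.extend E (v i)) fun i => mdiffAt_extend _)
  rw [covPsiForm_extend, covPsiForm_extend, covPsi, covPsi]
  change mvfderiv I ((fun q => Real.exp (n * f q)) • fun q => S.Psi q fun i =>
    (FiberBundle.extend E (v i) : Π q : M, TangentSpace I q) q) p u -
    ∑ i, Real.exp (n * f p) • S.Psi p _ = _
  rw [h1, ← Finset.smul_sum]
  simp only [FunLike.coe_add, Pi.add_apply, FunLike.coe_smul, Pi.smul_apply,
    ContinuousLinearMap.smulRight_apply, mvfderiv_exp_mul n hfp, FiberBundle.extend_apply_self,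
    Complex.real_smul]
  push_cast
  ring

/-- The covariant derivative of `Ψ` for the Levi-Civita connection of the conformal metric. -/
lemma covPsiForm_leviCivita_conformalMetric {p : M} {e : Fin n → TangentSpace I p}
    (he : IsUnitaryFrame (S.metric.inner p) (S.J p) e) (u : TangentSpace I p) :
    S.covPsiForm (leviCivita (conformalMetric S.metric f hf)) p u e =
      S.covPsiForm (leviCivita S.metric) p u e
        - n * (d% f p u : ℂ) * S.Psi p e + Complex.I * (d% f p (S.J p u) : ℂ) * S.Psi p e := by
  set F := sharp S.metric p (d% f p) with hF
  have hdf : ∀ w, S.metric.inner p F w = d% f p w := inner_sharp S.metric p _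
  have h := S.hermitian p
  have h1 := (S.psiForm_complexLinear p).sum_update_skew h he (S.finrank_tangentSpace p)
    (A := fun w => d% f p w • u - S.metric.inner p u w • F) (fun v w => by
      simp only [map_sub, map_smul, FunLike.coe_sub, FunLike.coe_smul, Pi.sub_apply,
        Pi.smul_apply, smul_eq_mul, h.symm v, hdf]
      ring)
  have h2 : ∑ i, S.metric.inner p (d% f p (e i) • u - S.metric.inner p u (e i) • F)
      (S.J p (e i)) = -d% f p (S.J p u) := by
    rw [← hdf (S.J p u), he.inner_eq_sum h (S.finrank_tangentSpace p) F, ← Finset.sum_neg_distrib]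
    refine Finset.sum_congr rfl fun i _ => ?_
    rw [h.orth, h.inner_J_left]
    simp only [map_sub, map_smul, FunLike.coe_sub, FunLike.coe_smul, Pi.sub_apply,
        Pi.smul_apply, smul_eq_mul, hdf]
    ring
  rw [h2] at h1
  simp only [psiForm_apply] at h1
  rw [S.covPsiForm_difference (leviCivita S.metric)]
  simp only [leviCivita_conformalMetric_difference, ← hF, add_sub_assoc]
  simp only [ContinuousAlternatingMap.map_update_add, ContinuousAlternatingMap.map_update_smul,
    Function.update_eq_self, Finset.sum_add_distrib]
  rw [h1]
  simp
  ring

lemma lineComponent_conformalChange (hn : n ≠ 0) (p : M) (u : TangentSpace I p) :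
    n * (S.conformalChange f hf).lineComponent p u =
      n * S.lineComponent p u + d% f p (S.J p u) := by
  obtain ⟨e, he⟩ := S.exists_unitaryFrame p
  set So := S.conformalChange f hf with hSo
  set t := Real.exp (-f p) with ht
  have htt : Real.exp (2 * f p) * (t * t) = 1 := by
    rw [ht, ← Real.exp_add, ← Real.exp_add]
    simp
    ring
  have heo : IsUnitaryFrame (So.metric.inner p) (So.J p) fun i => t • e i := by
    constructor
    · intro i j
      change Real.exp (2 * f p) * S.metric.inner p (t • e i) (t • e j) = _
      simp only [map_smul, FunLike.coe_smul, Pi.smul_apply, smul_eq_mul, he.inner_eq]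
      split_ifs
      · linarith
      · simp
    · intro i j
      change Real.exp (2 * f p) * S.metric.inner p (t • e i) (S.J p (t • e j)) = _
      simp [he.inner_J_eq]
  have h1 := So.covPsiForm_leviCivita hn heo u
  have h2 : ∀ T : (TangentSpace I p) [⋀^Fin n]→ₗ[ℝ] ℂ, T (fun i => t • e i) = (t : ℂ) ^ n * T e :=
    fun T => by
      have := T.toMultilinearMap.map_smul_univ (fun _ => t) e
      simpa using this
  rw [← psiForm_apply, h2, h2, mul_left_comm] at h1
  have ht0 : (t : ℂ) ^ n ≠ 0 := pow_ne_zero _ (by exact_mod_cast (Real.exp_pos _).ne')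
  have h3 := mul_left_cancel₀ ht0 h1
  have h4 : So.psiForm p e = (Real.exp (n * f p) : ℂ) * S.Psi p e := by
    change Real.exp (n * f p) • S.Psi p e = _
    rw [Complex.real_smul]
  have hexp : (Real.exp (n * f p) : ℂ) ≠ 0 := by exact_mod_cast (Real.exp_pos _).ne'
  rw [h4, hSo, covPsiForm_conformalChange, mul_left_comm _ (Real.exp (n * f p) : ℂ)] at h3
  have h5 := mul_left_cancel₀ hexp h3
  have h6 := S.covPsiForm_leviCivita_conformalMetric hf he u
  change S.covPsiForm (leviCivita (S.conformalChange f hf).metric) p u e = _ at h6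
  rw [h6, S.covPsiForm_leviCivita hn he] at h5
  have h7 : (Complex.I * S.Psi p e) ≠ 0 := mul_ne_zero Complex.I_ne_zero (S.psi_ne_zero he)
  have h8 : ((n * (S.conformalChange f hf).lineComponent p u : ℝ) : ℂ) =
      ((n * S.lineComponent p u + d% f p (S.J p u) : ℝ) : ℂ) := by
    apply mul_left_cancel₀ h7
    push_cast at h5 ⊢
    linear_combination -h5
  exact_mod_cast h8

end SpecialAlmostHermitian

end Manifold

end SpecialHermitian

theorem proposition2p10 {n : ℕ} (hn : 2 ≤ n)
    {E : Type*} [NormedAddCommGroup E] [NormedSpace ℝ E] [FiniteDimensional ℝ E]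
    {H : Type*} [TopologicalSpace H] {I : ModelWithCorners ℝ E H} [I.Boundaryless]
    {M : Type*} [TopologicalSpace M] [ChartedSpace H M] [IsManifold I ∞ M]
    (S : SpecialHermitian.SpecialAlmostHermitian n I M)
    (f : M → ℝ) (hf : ContMDiff I 𝓘(ℝ, ℝ) ∞ f) :
    (∀ (p : M) (u : TangentSpace I p),
      (S.conformalChange f hf).actCodiffOmega p u =
        S.actCodiffOmega p u - 2 * ((n : ℝ) - 1) * mvfderiv I f p u) ∧
    (∀ (p : M) (u : TangentSpace I p),
      (S.conformalChange f hf).eta p u = S.eta p u - (1 / (n : ℝ)) * mvfderiv I f p u) ∧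
    (∀ (p : M) (u : TangentSpace I p),
      2 * (n : ℝ) * ((n : ℝ) - 1) * (S.conformalChange f hf).eta p u
          - (S.conformalChange f hf).actCodiffOmega p u =
        2 * (n : ℝ) * ((n : ℝ) - 1) * S.eta p u - S.actCodiffOmega p u) := by
  have hn0 : n ≠ 0 := by omega
  have hn' : (n : ℝ) ≠ 0 := by exact_mod_cast hn0
  have h1 := S.actCodiffOmega_conformalChange hf
  have h2 : ∀ (p : M) (u : TangentSpace I p),
      (S.conformalChange f hf).eta p u = S.eta p u - (1 / (n : ℝ)) * mvfderiv I f p u := by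
    intro p u
    have h := S.lineComponent_conformalChange hf hn0 p (S.J p u)
    rw [S.J_sq, map_neg] at h
    have e1 : (S.conformalChange f hf).eta p u =
        (S.conformalChange f hf).lineComponent p (S.J p u) := neg_neg _
    have e2 : S.eta p u = S.lineComponent p (S.J p u) := neg_neg _
    rw [e1, e2]
    field_simp
    linarith
  refine ⟨h1, h2, fun p u => ?_⟩
  rw [h1, h2]
  field_simp
  ring
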